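/- Let $\omega_1,\omega_2\in\mathbb{C}$ be linearly independent over $\mathbb{R}$, let $\Omega=\mathbb{Z}\omega_1\oplus\mathbb{Z}\omega_2$, and put $\omega_0=0$, $\omega_3=-\omega_1-\omega_2$. Write $e(u)=\exp(2\pi\sqrt{-1}\,u)$, let $$\sigma(u;\Omega)=u\prod_{\omega\in\Omega\setminus\{0\}}\Bigl(1-\frac{u}{\omega}\Bigr)e^{\frac{u}{\omega}+\frac{u^2}{2\omega^2}}$$ be the Weierstrass sigma function, fix $\kappa\in\mathbb{C}$, and set $[u]=e(\kappa u^2)\,\sigma(u;\Omega)$ and $[x\pm y]=[x+y][x-y]$. For $\omega\in\Omega$ let $\epsilon_\omega=1$ if $\omega\in2\Omega$ and $\epsilon_\omega=-1$ otherwise, and let $\eta_\omega\in\mathbb{C}$ be the constant such that $[u+\omega]=\epsilon_\omega\, e(\eta_\omega(u+\frac{\omega}{2}))\,[u]$ for all $u$; put $\epsilon_s=\epsilon_{\omega_s}$, $\eta_s=\eta_{\omega_s}$ for $s=0,1,2,3$. Fix $\delta\in\mathbb{C}\setminus\{0\}$ with $\mathbb{Z}\delta\cap\Omega=\{0\}$.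 For $a=(a_0,\ldots,a_7)\in\mathbb{C}^8$ and $c=(c_0,\ldots,c_3)\in\mathbb{C}^4$ define $$A^{+}(x;a)=\frac{\prod_{p=0}^7[x+a_p]}{[2x][2x+\delta]},\qquad A^{-}(x;a)=\frac{\prod_{p=0}^7[x-a_p]}{[2x][2x-\delta]},$$ $$A^0(x;a|c)=\sum_{s=0}^3\epsilon_s\, e\Bigl(\bigl(\delta-\tfrac{\omega_s}{2}-\tfrac12\textstyle\sum_{p=0}^7a_p\bigr)\eta_s\Bigr)\frac{[x\pm c_s]\prod_{p=0}^7[\frac12(\omega_s-\delta)+a_p]}{2\,[\frac12(\omega_s-\delta)\pm x]\,[\frac12(\omega_s-\delta)\pm c_s]}.$$ For $z=(z_1,\ldots,z_N)$, $w=(w_1,\ldots,w_N)\in\mathbb{C}^N$ and $0\le r\le N$ put \begin{align*} S_r(z,w;a|c)=&\sum_{\substack{I\subset\{1,\ldots,N\}\\|I|=r}}\ \sum_{I_+\cup I_0\cup I_-=I}\ \prod_{i\in I_+}A^+(z_i;a)\prod_{i\in I_0}A^0(z_i;a|c)\prod_{i\in I_-}A^-(z_i;a)\\ &\cdot\prod_{\{i,j\}\subset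 I_+}\frac{[z_i+z_j+2\delta]}{[z_i+z_j]}\prod_{\{i,j\}\subset I_-}\frac{[z_i+z_j-2\delta]}{[z_i+z_j]}\prod_{\substack{i\in I_+\\ j\in I_-}}\frac{[z_i-z_j+2\delta]}{[z_i-z_j]}\\ &\cdot\prod_{\substack{i\in I_+\\ j\notin I_+\cup I_-}}\frac{[z_i+\delta\pm z_j]}{[z_i\pm z_j]}\prod_{\substack{i\in I_-\\ j\notin I_+\cup I_-}}\frac{[z_i-\delta\pm z_j]}{[z_i\pm z_j]}\prod_{\substack{i\in I_+\\1\le k\le N}}\frac{[z_i\pm w_k]}{[z_i+\delta\pm w_k]}\prod_{\substack{i\in I_-\\1\le k\le N}}\frac{[z_i\pm w_k]}{[z_i-\delta\pm w_k]}. \end{align*} Here the second sum is over all triples $(I_+,I_0,I_-)$ of pairwise disjoint subsets of $I$ with union $I$; the products over $\{i,j\}\subset I_\pm$ are over the two-element subsets; and $j\notin I_+\cup I_-$ means that $j$ runs over all elements of $\{1,\ldots,N\}\setminus(I_+\cup I_-)$. \textbf{Theorem.} Let $a_0,\ldots,a_7\in\mathbb{C}$ satisfy the balancing condition $\sum_{p=0}^7a_p=4\delta$,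 and set $b_p=\delta-a_p$ for $p=0,\ldots,7$ (so that $\sum_{p=0}^7 b_p=4\delta$ as well). Let $c\in\mathbb{C}^4$, let $N\ge0$, and let $z,w\in\mathbb{C}^N$ be such that none of the following denominators vanishes, for all $i,k\in\{1,\ldots,N\}$, $s\in\{0,1,2,3\}$: $[2z_i]$, $[2z_i\pm\delta]$, $[\frac12(\omega_s-\delta)\pm z_i]$, $[\frac12(\omega_s-\delta)\pm c_s]$, $[z_i\pm z_k]$ for $i\ne k$, $[z_i+\delta\pm w_k]$, $[z_i-\delta\pm w_k]$, and the same with $z$ and $w$ exchanged. Then $$S_r(z,w;a|c)=S_r(w,z;b|c)\qquad(r=0,1,\ldots,N).$$ -/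

import Mathlib

open scoped BigOperators

noncomputable section

namespace BCDuality

/-- The normalized exponential `e(u) = exp(2πi u)`. -/
def e (u : ℂ) : ℂ := Complex.exp (2 * Real.pi * Complex.I * u)

/-- The Weierstrass sigma function of the period lattice `Ω = ℤω₁ ⊕ ℤω₂`. -/
def sigma (L : PeriodPair) (u : ℂ) : ℂ :=
  u * ∏' ω : {ω : ℂ // ω ∈ L.lattice ∧ ω ≠ 0},
    (1 - u / ω.1) * Complex.exp (u / ω.1 + u ^ 2 / (2 * ω.1 ^ 2))

/-- The function `[u] = e(κ u²) σ(u; Ω)`. -/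
def br (L : PeriodPair) (κ u : ℂ) : ℂ := e (κ * u ^ 2) * sigma L u

/-- The abbreviation `[x ± y] = [x + y][x - y]`. -/
def brpm (L : PeriodPair) (κ x y : ℂ) : ℂ := br L κ (x + y) * br L κ (x - y)

open Classical in
/-- The sign `ε_ω`: it is `1` if `ω ∈ 2Ω` and `-1` otherwise. -/
def epsilonSign (L : PeriodPair) (ω : ℂ) : ℂ :=
  if ∃ ω' ∈ L.lattice, ω = 2 * ω' then 1 else -1

/-- The constant `η_ω` of the quasi-periodicity of `[u]`: for `ω ∈ Ω` it is the (one and only) complex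
number with `[u + ω] = ε_ω e(η_ω (u + ω/2)) [u]` for all `u`. -/
def eta (L : PeriodPair) (κ ω : ℂ) : ℂ :=
  Classical.epsilon fun η : ℂ =>
    ∀ u : ℂ, br L κ (u + ω) = epsilonSign L ω * e (η * (u + ω / 2)) * br L κ u

/-- `ω_0 = 0`, the basic periods `ω_1`, `ω_2`, and `ω_3 = -ω_1 - ω_2`. -/
def om (L : PeriodPair) : Fin 4 → ℂ := ![0, L.ω₁, L.ω₂, -L.ω₁ - L.ω₂]

/-- `A⁺(x; a) = ∏_p [x + a_p] / ([2x][2x + δ])`. -/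
def APlus (L : PeriodPair) (κ δ : ℂ) (a : Fin 8 → ℂ) (x : ℂ) : ℂ :=
  (∏ p, br L κ (x + a p)) / (br L κ (2 * x) * br L κ (2 * x + δ))

/-- `A⁻(x; a) = ∏_p [x - a_p] / ([2x][2x - δ])`. -/
def AMinus (L : PeriodPair) (κ δ : ℂ) (a : Fin 8 → ℂ) (x : ℂ) : ℂ :=
  (∏ p, br L κ (x - a p)) / (br L κ (2 * x) * br L κ (2 * x - δ))

/-- The summand `A⁰_r(x; a | c)` of the potential. -/
def AZeroTerm (L : PeriodPair) (κ δ : ℂ) (a : Fin 8 → ℂ) (r : Fin 4) (c x : ℂ) : ℂ :=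
  epsilonSign L (om L r) * e ((δ - om L r / 2 - (∑ p, a p) / 2) * eta L κ (om L r)) *
    ((brpm L κ x c * ∏ p, br L κ ((om L r - δ) / 2 + a p)) /
      (2 * brpm L κ ((om L r - δ) / 2) x * brpm L κ ((om L r - δ) / 2) c))

/-- `A⁰(x; a | c) = ∑_r A⁰_r(x; a | c_r)`. -/
def AZero (L : PeriodPair) (κ δ : ℂ) (a : Fin 8 → ℂ) (c : Fin 4 → ℂ) (x : ℂ) : ℂ :=
  ∑ r, AZeroTerm L κ δ a r (c r) x

/-- The triples `(I₊, I₀, I₋)` of subsets of `I` with `I₊ ∪ I₀ ∪ I₋ = I` and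
`|I₊| + |I₀| + |I₋| = |I|`. -/
def triples {N : ℕ} (I : Finset (Fin N)) :
    Finset (Finset (Fin N) × Finset (Fin N) × Finset (Fin N)) :=
  (I.powerset ×ˢ I.powerset ×ˢ I.powerset).filter fun t =>
    t.1 ∪ t.2.1 ∪ t.2.2 = I ∧ t.1.card + t.2.1.card + t.2.2.card = I.card

/-- The summand attached to the triple `(I₊, I₀, I₋)`. In the two middle products `j` runs over all
indices outside `I₊ ∪ I₋`, that is, over all indices whose variable is not shifted. -/
def term (L : PeriodPair) (κ δ : ℂ) (a : Fin 8 → ℂ) (c : Fin 4 → ℂ) {N : ℕ} (z w : Fin N → ℂ)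
    (Ip I0 Im : Finset (Fin N)) : ℂ :=
  (∏ i ∈ Ip, APlus L κ δ a (z i)) * (∏ i ∈ I0, AZero L κ δ a c (z i)) *
    (∏ i ∈ Im, AMinus L κ δ a (z i)) *
    (∏ i ∈ Ip, ∏ j ∈ Ip with i < j, br L κ (z i + z j + 2 * δ) / br L κ (z i + z j)) *
    (∏ i ∈ Im, ∏ j ∈ Im with i < j, br L κ (z i + z j - 2 * δ) / br L κ (z i + z j)) *
    (∏ i ∈ Ip, ∏ j ∈ Im, br L κ (z i - z j + 2 * δ) / br L κ (z i - z j)) *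
    (∏ i ∈ Ip, ∏ j ∈ (Ip ∪ Im)ᶜ, brpm L κ (z i + δ) (z j) / brpm L κ (z i) (z j)) *
    (∏ i ∈ Im, ∏ j ∈ (Ip ∪ Im)ᶜ, brpm L κ (z i - δ) (z j) / brpm L κ (z i) (z j)) *
    (∏ i ∈ Ip, ∏ k, brpm L κ (z i) (w k) / brpm L κ (z i + δ) (w k)) *
    (∏ i ∈ Im, ∏ k, brpm L κ (z i) (w k) / brpm L κ (z i - δ) (w k))

/-- One side of the duality: the sum over the subsets `I` with `|I| = r` and over the triples
`(I₊, I₀, I₋)` that make up `I`. -/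
def subsetSum (L : PeriodPair) (κ δ : ℂ) (a : Fin 8 → ℂ) (c : Fin 4 → ℂ) {N : ℕ}
    (z w : Fin N → ℂ) (r : ℕ) : ℂ :=
  ∑ I ∈ (Finset.univ : Finset (Fin N)).powersetCard r,
    ∑ t ∈ triples I, term L κ δ a c z w t.1 t.2.1 t.2.2

/-- No denominator occurring in `subsetSum L κ δ a c z w r` vanishes. -/
structure NonDegenerate (L : PeriodPair) (κ δ : ℂ) (c : Fin 4 → ℂ) {N : ℕ} (z w : Fin N → ℂ) :
    Prop where
  two_mul_ne : ∀ i, br L κ (2 * z i) ≠ 0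
  two_mul_add_ne : ∀ i, br L κ (2 * z i + δ) ≠ 0
  two_mul_sub_ne : ∀ i, br L κ (2 * z i - δ) ≠ 0
  half_ne : ∀ r i, brpm L κ ((om L r - δ) / 2) (z i) ≠ 0
  half_c_ne : ∀ r, brpm L κ ((om L r - δ) / 2) (c r) ≠ 0
  pair_ne : ∀ i j, i ≠ j → brpm L κ (z i) (z j) ≠ 0
  add_ne : ∀ i k, brpm L κ (z i + δ) (w k) ≠ 0
  sub_ne : ∀ i k, brpm L κ (z i - δ) (w k) ≠ 0

end BCDuality

end

/-! The `S_r` are the coefficients of a quotient of determinants. Let `K_T` be the `N × N` matrix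
with entries `1/[z_i ± w_k] + T (A⁺(z_i)/[z_i + δ ± w_k] + A⁰(z_i)/[z_i ± w_k] + A⁻(z_i)/[z_i - δ ±
w_k])`. Expanding `det K_T` along its rows gives, for each choice of one summand per row, a Cauchy
determinant in shifted variables. The elliptic Cauchy formula of type C evaluates them all, and
dividing by `det (1/[z_i ± w_k])` leaves exactly `∑ S_r T^r` (`sum_stateTerm`, `stateTerm_eq`).

Exchanging `z` with `w` and `a` with `b` turns both matrices into minus their transposes, so the
quotient is unchanged. For the Cauchy matrix this is the antisymmetry of `[x ± y]`; for the
coefficient of `T` it is an identity in one pair `(z_i, w_k)` (`kernel_duality`). That identity is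
an elliptic partial fraction identity with zeros `δ/2 - a_p` and poles `±z + δ/2`, `±w - δ/2` and
the four half periods; the balancing condition is what makes the sum of the zeros equal that of the
poles. The half periods produce `A⁰(z; a | c) - A⁰(w; a | c)`, and `A⁰` is the same for `a` and `b`.

The analytic input is the quasi-periodicity of sigma. With Liouville's theorem it gives the
three-term relation and the duplication formula; the three-term relation in turn yields the partial
fraction identity and the Cauchy determinant. The determinants need `[z_i ± w_k] ≠ 0`, which is not
assumed; continuity removes this condition at the end. -/

noncomputable section

namespace BCDuality

open Filter Topology

/-! ### The sigma function as a canonical product, and its logarithmic derivative -/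

section

/-- The elementary factor `(1 - v) exp(v + v²/2)`. -/
def elementaryFactor (v : ℂ) : ℂ := (1 - v) * Complex.exp (v + v ^ 2 / 2)

lemma differentiable_elementaryFactor : Differentiable ℂ elementaryFactor := by
  unfold elementaryFactor; fun_prop

@[simp] lemma elementaryFactor_zero : elementaryFactor 0 = 1 := by simp [elementaryFactor]

lemma elementaryFactor_eq_zero_iff {v : ℂ} : elementaryFactor v = 0 ↔ v = 1 := by
  simp [elementaryFactor, Complex.exp_ne_zero, sub_eq_zero, eq_comm (a := (1 : ℂ))]

/-- The exponent cancels the Taylor polynomial of `log (1 - v)` to second order. The cubic bound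
suffices because the lattice has rank two. -/
lemma norm_elementaryFactor_sub_one_le {v : ℂ} (hv : ‖v‖ ≤ 1 / 2) :
    ‖elementaryFactor v - 1‖ ≤ 2 * ‖v‖ ^ 3 := by
  have h1 : ‖-v‖ < 1 := by rw [norm_neg]; linarith
  have hne : 1 + -v ≠ 0 := by
    intro h
    have : v = 1 := by linear_combination -h
    rw [this] at hv; norm_num at hv
  have h2 := Complex.norm_log_sub_logTaylor_le 2 h1
  have h3 : Complex.logTaylor (2 + 1) (-v) = -(v + v ^ 2 / 2) := by
    simp [Complex.logTaylor_succ, Complex.logTaylor_zero]; ring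
  rw [h3, norm_neg, sub_neg_eq_add] at h2
  set t := Complex.log (1 + -v) + (v + v ^ 2 / 2) with ht
  have h4 : elementaryFactor v = Complex.exp t := by
    rw [ht, Complex.exp_add, Complex.exp_log hne, elementaryFactor, sub_eq_add_neg]
  have h5 : (1 - ‖v‖)⁻¹ ≤ 2 := by
    rw [inv_le_comm₀ (by linarith) (by norm_num)]; linarith
  have h6 : ‖t‖ ≤ ‖v‖ ^ 3 := by
    refine h2.trans ?_
    have : ‖v‖ ^ 3 * (1 - ‖v‖)⁻¹ ≤ ‖v‖ ^ 3 * 2 := by gcongr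
    have h0 : 0 ≤ ‖v‖ ^ 3 := by positivity
    norm_num
    linarith
  have h7 : ‖t‖ ≤ 1 := h6.trans (pow_le_one₀ (norm_nonneg _) (by linarith))
  rw [h4]
  exact (Complex.norm_exp_sub_one_le h7).trans (by linarith)

variable (L : PeriodPair)

lemma summable_norm_lattice_rpow :
    Summable fun l : L.lattice => ‖(l : ℂ)‖ ^ (-3 : ℝ) :=
  ZLattice.summable_norm_rpow _ _ (by simp; norm_num)

lemma eventually_cofinite_le_norm (R : ℝ) :
    ∀ᶠ l : L.lattice in cofinite, R ≤ ‖(l : ℂ)‖ := by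
  refine (isCompact_iff_finite.mp (isCompact_closedBall (0 : L.lattice) R)).subset ?_
  intro l hl
  simp only [Set.mem_compl_iff, Set.mem_ofPred_eq, not_le] at hl
  simpa using hl.le

lemma norm_elementaryFactor_div_sub_one_le {r : ℝ} (hr : 0 < r) {l u : ℂ} (hl : 2 * r ≤ ‖l‖)
    (hu : ‖u‖ < r) : ‖elementaryFactor (u / l) - 1‖ ≤ 2 * r ^ 3 * ‖l‖ ^ (-3 : ℝ) := by
  have hl0 : 0 < ‖l‖ := by linarith
  have h : ‖u / l‖ ≤ r / ‖l‖ := by rw [norm_div]; gcongr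
  have h' : ‖u / l‖ ≤ 1 / 2 := h.trans (by rw [div_le_div_iff₀ hl0 two_pos]; linarith)
  refine (norm_elementaryFactor_sub_one_le h').trans ?_
  calc 2 * ‖u / l‖ ^ 3 ≤ 2 * (r / ‖l‖) ^ 3 := by gcongr
    _ = _ := by
      rw [Real.rpow_neg hl0.le, div_pow]
      norm_cast
      ring

/-- The product over the lattice in `sigma`, the trivial factor of `0` included. -/
def sigmaProd (u : ℂ) : ℂ := ∏' l : L.lattice, elementaryFactor (u / l)

lemma sigma_eq_mul_sigmaProd (u : ℂ) : sigma L u = u * sigmaProd L u := by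
  unfold sigma sigmaProd
  congr 1
  let g : {ω : ℂ // ω ∈ L.lattice ∧ ω ≠ 0} → L.lattice := fun ω => ⟨ω.1, ω.2.1⟩
  have hg : Function.Injective g := fun x y h => Subtype.ext (by simpa [g] using h)
  rw [← hg.tprod_eq (f := fun l : L.lattice => elementaryFactor (u / l))]
  · refine tprod_congr fun ω => ?_
    simp only [elementaryFactor, g]
    congr 3
    field_simp
  · intro l hl
    have : (l : ℂ) ≠ 0 := by
      rintro h
      simp [h] at hl
    exact ⟨⟨l, l.2, this⟩, rfl⟩

lemma multipliableLocallyUniformlyOn_elementaryFactor (r : ℝ) (hr : 0 < r) :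
    MultipliableLocallyUniformlyOn (fun (l : L.lattice) (u : ℂ) => elementaryFactor (u / l))
      (Metric.ball 0 r) := by
  have := Summable.multipliableLocallyUniformlyOn_one_add
    (f := fun (l : L.lattice) (u : ℂ) => elementaryFactor (u / l) - 1)
    (K := Metric.ball 0 r) Metric.isOpen_ball
    ((summable_norm_lattice_rpow L).mul_left (2 * r ^ 3)) ?_ ?_
  · simpa using this
  · filter_upwards [eventually_cofinite_le_norm L (2 * r)] with l hl u hu
    exact norm_elementaryFactor_div_sub_one_le hr hl (by simpa using hu)
  · intro l
    have := differentiable_elementaryFactor.continuous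
    exact Continuous.continuousOn (by fun_prop)

lemma summable_norm_elementaryFactor_sub_one (u : ℂ) :
    Summable fun l : L.lattice => ‖elementaryFactor (u / l) - 1‖ := by
  have hr : 0 < ‖u‖ + 1 := by positivity
  refine ((summable_norm_lattice_rpow L).mul_left (2 * (‖u‖ + 1) ^ 3)).of_norm_bounded_eventually ?_
  filter_upwards [eventually_cofinite_le_norm L (2 * (‖u‖ + 1))] with l hl
  rw [norm_norm]
  exact norm_elementaryFactor_div_sub_one_le hr hl (by linarith)

lemma differentiable_sigmaProd : Differentiable ℂ (sigmaProd L) := by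
  intro u
  have hr : 0 < ‖u‖ + 1 := by positivity
  have h := (multipliableLocallyUniformlyOn_elementaryFactor L _ hr).hasProdLocallyUniformlyOn
  have hd : DifferentiableOn ℂ (sigmaProd L) (Metric.ball 0 (‖u‖ + 1)) := by
    refine TendstoLocallyUniformlyOn.differentiableOn h (.of_forall fun s => ?_) Metric.isOpen_ball
    have := differentiable_elementaryFactor
    exact Differentiable.differentiableOn (by fun_prop)
  exact hd.differentiableAt (Metric.isOpen_ball.mem_nhds (by simp))

@[simp] lemma sigmaProd_zero : sigmaProd L 0 = 1 := by simp [sigmaProd]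

lemma elementaryFactor_div_ne_zero {u : ℂ} (hu : u ∉ L.lattice) (l : L.lattice) :
    elementaryFactor (u / l) ≠ 0 := by
  rw [Ne, elementaryFactor_eq_zero_iff]
  intro h
  have h0 : (l : ℂ) ≠ 0 := by rintro h'; simp [h'] at h
  rw [div_eq_one_iff_eq h0] at h
  exact hu (h ▸ l.2)

lemma sigmaProd_ne_zero {u : ℂ} (hu : u ∉ L.lattice) : sigmaProd L u ≠ 0 := by
  have := tprod_one_add_ne_zero_of_summable
    (f := fun l : L.lattice => elementaryFactor (u / l) - 1)
    (fun l => by simpa using elementaryFactor_div_ne_zero L hu l)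
    (summable_norm_elementaryFactor_sub_one L u)
  simpa [sigmaProd] using this

lemma sigma_ne_zero {u : ℂ} (hu : u ∉ L.lattice) : sigma L u ≠ 0 := by
  rw [sigma_eq_mul_sigmaProd]
  refine mul_ne_zero ?_ (sigmaProd_ne_zero L hu)
  rintro rfl
  exact hu (zero_mem _)

lemma differentiable_sigma : Differentiable ℂ (sigma L) := by
  have h : sigma L = fun u => u * sigmaProd L u := funext (sigma_eq_mul_sigmaProd L)
  rw [h]
  have := differentiable_sigmaProd L
  fun_prop

@[simp] lemma sigma_zero : sigma L 0 = 0 := by simp [sigma_eq_mul_sigmaProd]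

lemma deriv_sigma_zero : deriv (sigma L) 0 = 1 := by
  have h : sigma L = fun u => u * sigmaProd L u := funext (sigma_eq_mul_sigmaProd L)
  rw [h, deriv_fun_mul differentiableAt_fun_id (differentiable_sigmaProd L 0)]
  simp

lemma sigma_neg (u : ℂ) : sigma L (-u) = -sigma L u := by
  rw [sigma_eq_mul_sigmaProd, sigma_eq_mul_sigmaProd, sigmaProd,
    ← (Equiv.neg L.lattice).tprod_eq]
  simp [sigmaProd, neg_div_neg_eq]

/-- The Weierstrass zeta function of the period lattice. -/
def zeta (u : ℂ) : ℂ := ∑' l : L.lattice, (1 / (u - l) + 1 / l + u / (l : ℂ) ^ 2)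

lemma logDeriv_elementaryFactor_div {u : ℂ} {l : L.lattice} (hu : u ∉ L.lattice) (hl : l ≠ 0) :
    logDeriv (fun v : ℂ => elementaryFactor (v / l)) u = 1 / (u - l) + 1 / l + u / (l : ℂ) ^ 2 := by
  have h0 : (l : ℂ) ≠ 0 := by simpa using hl
  have h1 : u - l ≠ 0 := by
    rw [sub_ne_zero]; rintro rfl; exact hu l.2
  have h2 : (l : ℂ) - u ≠ 0 := by rw [← neg_sub]; exact neg_ne_zero.2 h1
  have h3 : (1 : ℂ) - u / l ≠ 0 := by
    rw [one_sub_div h0]; exact div_ne_zero h2 h0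
  simp only [elementaryFactor]
  rw [logDeriv_mul (f := fun v : ℂ => 1 - v / l)
    (g := fun v : ℂ => Complex.exp (v / l + (v / l) ^ 2 / 2)) _ h3 (Complex.exp_ne_zero _)
    (by fun_prop) (by fun_prop)]
  have d1 : HasDerivAt (fun v : ℂ => 1 - v / l) (-(1 / l)) u :=
    ((hasDerivAt_id u).div_const (l : ℂ)).const_sub 1
  have d2 : HasDerivAt (fun v : ℂ => Complex.exp (v / l + (v / l) ^ 2 / 2))
      (Complex.exp (u / l + (u / l) ^ 2 / 2) * (1 / l + (2 * (u / l) ^ 1 * (1 / l)) / 2)) u := by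
    have e1 := (hasDerivAt_id u).div_const (l : ℂ)
    exact (e1.add ((e1.pow 2).div_const 2)).cexp
  rw [logDeriv_apply, logDeriv_apply, d1.deriv, d2.deriv,
    mul_div_cancel_left₀ _ (Complex.exp_ne_zero _)]
  field_simp
  ring

lemma zetaSummand_bound {r : ℝ} (hr : 0 < r) {s l : ℂ} (hs : ‖s‖ < r) (h : 2 * r ≤ ‖l‖) :
    ‖1 / (s - l) + 1 / l + s / l ^ 2‖ ≤ 2 * r ^ 2 * ‖l‖ ^ (-3 : ℝ) := by
  have hl0 : 0 < ‖l‖ := by linarith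
  have h0 : l ≠ 0 := norm_pos_iff.1 hl0
  have h2 : ‖l‖ / 2 ≤ ‖s - l‖ := by
    rw [norm_sub_rev]
    exact .trans (by linarith) (norm_sub_norm_le l s)
  have h1 : s - l ≠ 0 := norm_pos_iff.1 (by linarith)
  have e1 : 1 / (s - l) + 1 / l + s / l ^ 2 = s ^ 2 / ((s - l) * l ^ 2) := by
    field_simp; ring
  rw [e1, norm_div, norm_mul, norm_pow, norm_pow]
  calc ‖s‖ ^ 2 / (‖s - l‖ * ‖l‖ ^ 2) ≤ r ^ 2 / ((‖l‖ / 2) * ‖l‖ ^ 2) := by gcongr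
    _ = 2 * r ^ 2 * (‖l‖ ^ 3)⁻¹ := by field_simp
    _ = _ := by rw [Real.rpow_neg hl0.le]; norm_cast

lemma hasSumLocallyUniformly_zeta :
    HasSumLocallyUniformly
      (fun (l : L.lattice) (u : ℂ) => 1 / (u - l) + 1 / l + u / (l : ℂ) ^ 2) (zeta L) := by
  refine L.hasSumLocallyUniformly_aux (u := fun r l => 2 * r ^ 2 * ‖(l : ℂ)‖ ^ (-3 : ℝ)) _
    (fun r _ => (summable_norm_lattice_rpow L).mul_left _) fun r hr =>
    Filter.eventually_atTop.mpr ⟨2 * r, ?_⟩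
  rintro _ h s hs l rfl
  exact zetaSummand_bound hr hs h

lemma isOpen_compl_lattice : IsOpen (L.lattice : Set ℂ)ᶜ := L.isClosed_lattice.isOpen_compl

lemma hasDerivAt_zeta {u : ℂ} (hu : u ∉ L.lattice) :
    HasDerivAt (zeta L) (-L.weierstrassP u) u := by
  have hd : ∀ (l : L.lattice), ∀ v ∈ (L.lattice : Set ℂ)ᶜ,
      HasDerivAt (fun v : ℂ => 1 / (v - l) + 1 / l + v / (l : ℂ) ^ 2)
        (-(1 / (v - l) ^ 2 - 1 / (l : ℂ) ^ 2)) v := by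
    intro l v hv
    have h1 : v - l ≠ 0 := by
      rw [sub_ne_zero]; rintro rfl; exact hv l.2
    have e1 := (((hasDerivAt_id v).sub_const (l : ℂ)).fun_inv h1).add_const (1 / (l : ℂ))
    have e2 := e1.add ((hasDerivAt_id v).div_const ((l : ℂ) ^ 2))
    convert! e2 using 1
    · ext; simp
    · simp; ring
  have hT := (hasSumLocallyUniformly_zeta L).tendstoLocallyUniformlyOn (s := (L.lattice : Set ℂ)ᶜ)
  have hF : ∀ᶠ s : Finset L.lattice in atTop, DifferentiableOn ℂ
      (fun u => ∑ l ∈ s, (1 / (u - l) + 1 / l + u / (l : ℂ) ^ 2)) (L.lattice : Set ℂ)ᶜ :=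
    .of_forall fun s => .fun_sum fun l _ v hv => (hd l v hv).differentiableAt.differentiableWithinAt
  have hdiff := (hT.differentiableOn hF (isOpen_compl_lattice L)).differentiableAt
    ((isOpen_compl_lattice L).mem_nhds hu)
  have hderiv := (hT.deriv hF (isOpen_compl_lattice L)).tendsto_at hu
  have hP := (L.hasSum_weierstrassP u).neg
  have : deriv (zeta L) u = -L.weierstrassP u := by
    refine tendsto_nhds_unique hderiv (Tendsto.congr (fun s => ?_) hP)
    simp only [Function.comp_apply]
    exact (HasDerivAt.fun_sum fun l _ => hd l u hu).deriv.symm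
  rw [← this]
  exact hdiff.hasDerivAt

lemma logDeriv_sigma {u : ℂ} (hu : u ∉ L.lattice) : logDeriv (sigma L) u = zeta L u := by
  have hu0 : u ≠ 0 := by rintro rfl; exact hu (zero_mem _)
  have h : sigma L = fun u => u * sigmaProd L u := funext (sigma_eq_mul_sigmaProd L)
  rw [h, logDeriv_mul (f := fun u : ℂ => u) (g := sigmaProd L) u hu0 (sigmaProd_ne_zero L hu)
    (by fun_prop) (differentiable_sigmaProd L u), logDeriv_id']
  have hr : 0 < ‖u‖ + 1 := by positivity
  have hz := (hasSumLocallyUniformly_zeta L).hasSum (x := u)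
  -- With `1 / 0 = 0`, the term `l = 0` of `zeta` is `1 / u`, whereas the factor `l = 0` of the
  -- product is constantly `1`; the difference is the factor `u` of sigma.
  have hsplit : HasSum (fun l : L.lattice => logDeriv (fun v : ℂ => elementaryFactor (v / l)) u)
      (zeta L u - 1 / u) := by
    have hs := (hasSum_ite_eq (0 : L.lattice) (1 / u))
    convert! hz.sub hs using 2 with l
    by_cases hl : l = 0
    · subst hl
      simp [logDeriv]
    · rw [logDeriv_elementaryFactor_div L hu hl]
      simp [hl]
  have := logDeriv_tprod_eq_tsum (s := Metric.ball (0 : ℂ) (‖u‖ + 1)) (x := u)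
    (f := fun (l : L.lattice) (u : ℂ) => elementaryFactor (u / l)) Metric.isOpen_ball (by simp)
    (elementaryFactor_div_ne_zero L hu)
    (fun l => by
      have := differentiable_elementaryFactor
      exact Differentiable.differentiableOn (by fun_prop))
    hsplit.summable (multipliableLocallyUniformlyOn_elementaryFactor L _ hr)
    (sigmaProd_ne_zero L hu)
  rw [hsplit.tsum_eq] at this
  change 1 / u + logDeriv (fun v => ∏' l : L.lattice, elementaryFactor (v / l)) u = _
  rw [this]
  simp

end

/-! ### Quasi-periodicity of sigma and of `br` -/

section

variable (L : PeriodPair) (κ : ℂ)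

lemma e_add (x y : ℂ) : e (x + y) = e x * e y := by
  rw [e, e, e, ← Complex.exp_add]; ring_nf

lemma e_ne_zero (x : ℂ) : e x ≠ 0 := Complex.exp_ne_zero _

@[simp] lemma e_zero : e 0 = 1 := by simp [e]

lemma e_neg (x : ℂ) : e (-x) = (e x)⁻¹ := by
  rw [e, e, ← Complex.exp_neg]; ring_nf

lemma differentiable_e : Differentiable ℂ e := by unfold e; fun_prop

lemma countable_lattice : (L.lattice : Set ℂ).Countable :=
  countable_of_Lindelof_of_discrete (X := L.lattice)

lemma dense_compl_lattice : Dense (L.lattice : Set ℂ)ᶜ :=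
  (countable_lattice L).dense_compl ℝ

lemma isPreconnected_compl_lattice : IsPreconnected (L.lattice : Set ℂ)ᶜ :=
  ((countable_lattice L).isConnected_compl_of_one_lt_rank (by simp)).2

lemma add_mem_lattice_iff {u ω : ℂ} (hω : ω ∈ L.lattice) :
    u + ω ∈ L.lattice ↔ u ∈ L.lattice :=
  Submodule.add_mem_iff_left _ hω

/-- Both sides have derivative `-℘`, and the complement of the countable lattice is connected. -/
lemma exists_zeta_add {ω : ℂ} (hω : ω ∈ L.lattice) :
    ∃ c, ∀ u ∉ L.lattice, zeta L (u + ω) = zeta L u + c := by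
  have hx : L.ω₁ / 2 ∈ (L.lattice : Set ℂ)ᶜ := L.ω₁_div_two_notMem_lattice
  refine ⟨zeta L (L.ω₁ / 2 + ω) - zeta L (L.ω₁ / 2), ?_⟩
  have hf : ∀ u ∈ (L.lattice : Set ℂ)ᶜ,
      HasDerivAt (fun u => zeta L (u + ω)) (-L.weierstrassP u) u := by
    intro u hu
    have := hasDerivAt_zeta L (u := u + ω) (by rwa [add_mem_lattice_iff L hω])
    have h2 := L.weierstrassP_add_coe u ⟨ω, hω⟩
    simp only at h2
    rw [h2] at this
    exact this.comp_add_const u ω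
  have hg : ∀ u ∈ (L.lattice : Set ℂ)ᶜ,
      HasDerivAt (fun u => zeta L u + (zeta L (L.ω₁ / 2 + ω) - zeta L (L.ω₁ / 2)))
        (-L.weierstrassP u) u := fun u hu => (hasDerivAt_zeta L hu).add_const _
  have := (isOpen_compl_lattice L).eqOn_of_deriv_eq (isPreconnected_compl_lattice L)
    (fun u hu => (hf u hu).differentiableAt.differentiableWithinAt)
    (fun u hu => (hg u hu).differentiableAt.differentiableWithinAt)
    (fun u hu => (hf u hu).deriv.trans (hg u hu).deriv.symm) hx (by ring)
  exact fun u hu => this hu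

/-- Off the lattice the logarithmic derivatives of `σ(u + ω)` and `exp(cu) σ(u)` agree, so the
functions are proportional there, and by density everywhere. -/
lemma exists_sigma_add {ω : ℂ} (hω : ω ∈ L.lattice) :
    ∃ c C : ℂ, C ≠ 0 ∧ ∀ u, sigma L (u + ω) = C * Complex.exp (c * u) * sigma L u := by
  obtain ⟨c, hc⟩ := exists_zeta_add L hω
  have hd := differentiable_sigma L
  have hlog : Set.EqOn (logDeriv fun u => sigma L (u + ω))
      (logDeriv fun u => Complex.exp (c * u) * sigma L u) (L.lattice : Set ℂ)ᶜ := by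
    intro u hu
    have h1 : logDeriv (fun u => sigma L (u + ω)) u = zeta L (u + ω) := by
      rw [← logDeriv_sigma L (by rwa [add_mem_lattice_iff L hω])]
      simp only [logDeriv_apply, deriv_comp_add_const]
    have h2 : HasDerivAt (fun u => Complex.exp (c * u)) (Complex.exp (c * u) * (c * 1)) u :=
      ((hasDerivAt_id u).const_mul c).cexp
    rw [h1, hc u hu, logDeriv_mul (f := fun u => Complex.exp (c * u)) (g := sigma L) u
      (Complex.exp_ne_zero _) (sigma_ne_zero L hu) (by fun_prop) (hd u), logDeriv_sigma L hu,
      logDeriv_apply, h2.deriv, mul_div_cancel_left₀ _ (Complex.exp_ne_zero _)]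
    ring
  rw [logDeriv_eqOn_iff (by fun_prop) (by fun_prop) (isOpen_compl_lattice L)
    (isPreconnected_compl_lattice L)] at hlog
  · obtain ⟨C, hC, h⟩ := hlog
    refine ⟨c, C, hC, fun u => ?_⟩
    have hd' := hd.continuous
    have := Continuous.ext_on (dense_compl_lattice L) (f := fun u => sigma L (u + ω))
      (g := fun u => C * Complex.exp (c * u) * sigma L u) (by fun_prop) (by fun_prop)
      (fun u hu => by rw [h hu]; simp [mul_assoc])
    exact congr_fun this u
  · exact fun u hu => mul_ne_zero (Complex.exp_ne_zero _) (sigma_ne_zero L hu)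
  · exact fun u hu => sigma_ne_zero L (by rwa [add_mem_lattice_iff L hω])

lemma sigma_eq_zero_iff {u : ℂ} : sigma L u = 0 ↔ u ∈ L.lattice := by
  refine ⟨fun h => by_contra fun hu => sigma_ne_zero L hu h, fun hu => ?_⟩
  obtain ⟨c, C, -, h⟩ := exists_sigma_add L hu
  simpa using h 0

lemma br_eq_zero_iff {u : ℂ} : br L κ u = 0 ↔ u ∈ L.lattice := by
  simp [br, e_ne_zero, sigma_eq_zero_iff]

@[simp] lemma br_zero : br L κ 0 = 0 := by simp [br]

lemma br_neg (u : ℂ) : br L κ (-u) = -br L κ u := by simp [br, sigma_neg]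

lemma differentiable_br : Differentiable ℂ (br L κ) := by
  unfold br
  have := differentiable_e
  have := differentiable_sigma L
  fun_prop

lemma deriv_br_zero : deriv (br L κ) 0 = 1 := by
  have h1 : Differentiable ℂ fun u => e (κ * u ^ 2) := by
    have := differentiable_e
    fun_prop
  change deriv (fun u => e (κ * u ^ 2) * sigma L u) 0 = 1
  rw [deriv_fun_mul (h1 0) (differentiable_sigma L 0)]
  simp [deriv_sigma_zero]

/-- Translation changes the Gaussian factor `e(κu²)` only by the exponential of an affine function.
-/
lemma exists_br_add {ω : ℂ} (hω : ω ∈ L.lattice) :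
    ∃ η C : ℂ, C ≠ 0 ∧ ∀ u, br L κ (u + ω) = C * e (η * u) * br L κ u := by
  obtain ⟨c, C, hC, h⟩ := exists_sigma_add L hω
  refine ⟨2 * κ * ω + c / (2 * Real.pi * Complex.I), C * e (κ * ω ^ 2),
    mul_ne_zero hC (e_ne_zero _), fun u => ?_⟩
  have h2 : e (κ * (u + ω) ^ 2) * Complex.exp (c * u) =
      e (κ * u ^ 2) * (e (κ * ω ^ 2) * e ((2 * κ * ω + c / (2 * Real.pi * Complex.I)) * u)) := by
    have hpi : (Real.pi : ℂ) ≠ 0 := by exact_mod_cast Real.pi_ne_zero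
    have : Complex.exp (c * u) = e (c / (2 * Real.pi * Complex.I) * u) := by
      rw [e]; congr 1; field_simp
    rw [this, ← e_add, ← e_add, ← e_add]
    congr 1; ring
  rw [br, br, h]
  linear_combination (C * sigma L u) * h2

lemma deriv_br_add {ω η C : ℂ} (h : ∀ u, br L κ (u + ω) = C * e (η * u) * br L κ u)
    {u : ℂ} (hu : br L κ u = 0) :
    deriv (br L κ) (u + ω) = C * e (η * u) * deriv (br L κ) u := by
  have h1 : Differentiable ℂ fun u => C * e (η * u) := by
    have := differentiable_e
    fun_prop
  have h2 : (fun u => br L κ (u + ω)) = fun u => C * e (η * u) * br L κ u := funext h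
  rw [← deriv_comp_add_const, h2, deriv_fun_mul (h1 u) (differentiable_br L κ u), hu]
  ring

lemma deriv_br_ne_zero {u : ℂ} (hu : u ∈ L.lattice) : deriv (br L κ) u ≠ 0 := by
  obtain ⟨η, C, hC, h⟩ := exists_br_add L κ hu
  have := deriv_br_add L κ h (br_zero L κ)
  rw [zero_add, deriv_br_zero] at this
  rw [this]
  simp [hC]

lemma deriv_br_neg (u : ℂ) : deriv (br L κ) (-u) = deriv (br L κ) u := by
  have h : (fun u => br L κ (-u)) = fun u => -br L κ u := funext (br_neg L κ)
  have h2 := congr_arg (fun f => deriv f u) h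
  simpa [deriv_comp_neg, deriv.fun_neg] using h2

/-- The defining property of `eta`. -/
lemma br_add {ω : ℂ} (hω : ω ∈ L.lattice) (u : ℂ) :
    br L κ (u + ω) = epsilonSign L ω * e (eta L κ ω * (u + ω / 2)) * br L κ u := by
  suffices h : ∃ η : ℂ, ∀ u, br L κ (u + ω) = epsilonSign L ω * e (η * (u + ω / 2)) * br L κ u from
    Classical.epsilon_spec h u
  obtain ⟨η, C, hC, h⟩ := exists_br_add L κ hω
  refine ⟨η, fun u => ?_⟩
  -- The constant is read off at `u = -ω/2`, which translation sends to `ω/2`. If `ω/2` is not a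
  -- period, oddness of `br` gives the sign `-1`; if it is, both values vanish and the even
  -- derivative gives `+1`.
  suffices hCe : C = epsilonSign L ω * e (η * (ω / 2)) by
    rw [h, hCe, mul_add, e_add]; ring
  have hω' : -(ω / 2) + ω = ω / 2 := by ring
  have he : e (η * -(ω / 2)) = (e (η * (ω / 2)))⁻¹ := by rw [← e_neg]; congr 1; ring
  have hne := e_ne_zero (η * (ω / 2))
  by_cases hh : ω / 2 ∈ L.lattice
  · have h1 := deriv_br_add L κ h (u := -(ω / 2)) ((br_eq_zero_iff L κ).2 (neg_mem hh))
    rw [hω', deriv_br_neg, he] at h1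
    have h2 := mul_right_cancel₀ (deriv_br_ne_zero L κ hh) ((one_mul _).trans h1)
    rw [epsilonSign, if_pos ⟨ω / 2, hh, by ring⟩]
    rw [one_mul, eq_comm]
    rwa [eq_mul_inv_iff_mul_eq₀ hne, one_mul] at h2
  · have h1 := h (-(ω / 2))
    generalize e (η * (ω / 2)) = E at *
    have h0 : br L κ (ω / 2) ≠ 0 := fun h0 => hh ((br_eq_zero_iff L κ).1 h0)
    rw [hω', br_neg, he] at h1
    rw [epsilonSign, if_neg]
    · field_simp at h1
      linear_combination h1
    · rintro ⟨ω', h', rfl⟩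
      exact hh (by simpa using h')

end

/-! ### Liouville's theorem and the three-term relation -/

section

variable (L : PeriodPair) (κ : ℂ)

/-- Every value is taken on a fundamental domain, whose closure is compact. -/
lemma exists_norm_le_of_lattice_periodic {h : ℂ → ℂ} (hc : Continuous h)
    (hper : ∀ ω ∈ L.lattice, ∀ u, h (u + ω) = h u) : ∃ M, ∀ u, ‖h u‖ ≤ M := by
  have hb := (ZSpan.fundamentalDomain_isBounded L.basis).isCompact_closure
  obtain ⟨M, hM⟩ := hb.exists_bound_of_continuousOn hc.continuousOn
  refine ⟨M, fun u => ?_⟩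
  have h1 := hM _ (subset_closure (ZSpan.fract_mem_fundamentalDomain L.basis u))
  have h2 : ((ZSpan.floor L.basis u : Submodule.span ℤ (Set.range L.basis)) : ℂ) ∈ L.lattice := by
    rw [L.lattice_eq_span_range_basis]
    exact (ZSpan.floor L.basis u).2
  rw [← hper _ h2, ZSpan.fract_apply, sub_add_cancel] at h1
  exact h1

/-- Two entire functions with the same multipliers are proportional if the second one has only
simple zeros, and these are zeros of the first one. -/
theorem exists_eq_const_mul {f g : ℂ → ℂ} (hf : Differentiable ℂ f) (hg : Differentiable ℂ g)
    (hz : ∀ u, g u = 0 → f u = 0 ∧ deriv g u ≠ 0)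
    (hper : ∀ ω ∈ L.lattice, ∃ m : ℂ → ℂ, Differentiable ℂ m ∧ ∀ u, m u ≠ 0 ∧
      f (u + ω) = m u * f u ∧ g (u + ω) = m u * g u) :
    ∃ C, ∀ u, f u = C * g u := by
  classical
  -- The quotient `f / g`, with its removable singularities filled in by l'Hôpital's rule. It is
  -- entire and lattice-periodic, hence constant.
  set h : ℂ → ℂ := fun u => if g u = 0 then deriv f u / deriv g u else f u / g u with hdef
  have hfg : ∀ u, f u = h u * g u := by
    intro u
    by_cases h0 : g u = 0
    · rw [h0, mul_zero, (hz u h0).1]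
    · simp [hdef, h0]
  have hdiff : Differentiable ℂ h := by
    intro u₀
    by_cases h0 : g u₀ = 0
    · obtain ⟨hf0, hg0⟩ := hz u₀ h0
      have ds : ∀ k : ℂ → ℂ, Differentiable ℂ k → Differentiable ℂ (dslope k u₀) := by
        intro k hk
        rw [← differentiableOn_univ, Complex.differentiableOn_dslope univ_mem]
        exact hk.differentiableOn
      have hne : dslope g u₀ u₀ ≠ 0 := by rwa [dslope_same]
      have hev : ∀ᶠ v in 𝓝 u₀, dslope g u₀ v ≠ 0 :=
        (ds g hg).continuous.continuousAt.eventually_ne hne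
      have heq : h =ᶠ[𝓝 u₀] fun v => dslope f u₀ v / dslope g u₀ v := by
        filter_upwards [hev] with v hv
        rcases eq_or_ne v u₀ with rfl | hvu
        · simp [hdef, h0]
        · have hs : v - u₀ ≠ 0 := sub_ne_zero.2 hvu
          have e1 : g v = (v - u₀) * dslope g u₀ v := by
            have := sub_smul_dslope g u₀ v
            rw [h0, sub_zero, smul_eq_mul] at this
            exact this.symm
          have e2 : f v = (v - u₀) * dslope f u₀ v := by
            have := sub_smul_dslope f u₀ v
            rw [hf0, sub_zero, smul_eq_mul] at this
            exact this.symm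
          simp only [hdef]
          rw [if_neg (by rw [e1]; exact mul_ne_zero hs hv), e1, e2, mul_div_mul_left _ _ hs]
      exact (((ds f hf) u₀).fun_div ((ds g hg) u₀) hne).congr_of_eventuallyEq heq
    · have heq : h =ᶠ[𝓝 u₀] fun v => f v / g v := by
        filter_upwards [hg.continuous.continuousAt.eventually_ne h0] with v hv
        simp [hdef, hv]
      exact ((hf u₀).fun_div (hg u₀) h0).congr_of_eventuallyEq heq
  have hperh : ∀ ω ∈ L.lattice, ∀ u, h (u + ω) = h u := by
    intro ω hω u
    obtain ⟨m, hm, H⟩ := hper ω hω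
    have hdm : ∀ k : ℂ → ℂ, Differentiable ℂ k → (∀ u, k (u + ω) = m u * k u) → k u = 0 →
        deriv k (u + ω) = m u * deriv k u := by
      intro k hk hku h0
      have : (fun u => k (u + ω)) = fun u => m u * k u := funext hku
      rw [← deriv_comp_add_const, this, deriv_fun_mul (hm u) (hk u), h0]
      ring
    have hmu := (H u).1
    by_cases h0 : g u = 0
    · have h0' : g (u + ω) = 0 := by rw [(H u).2.2, h0, mul_zero]
      simp only [hdef, h0, h0', if_true]
      rw [hdm f hf (fun u => (H u).2.1) (hz u h0).1, hdm g hg (fun u => (H u).2.2) h0,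
        mul_div_mul_left _ _ hmu]
    · have h0' : g (u + ω) ≠ 0 := by rw [(H u).2.2]; exact mul_ne_zero hmu h0
      simp only [hdef, h0, h0', if_false]
      rw [(H u).2.1, (H u).2.2, mul_div_mul_left _ _ hmu]
  obtain ⟨M, hM⟩ := exists_norm_le_of_lattice_periodic L hdiff.continuous hperh
  refine ⟨h 0, fun u => ?_⟩
  rw [hfg, hdiff.apply_eq_apply_of_bounded (isBounded_iff_forall_norm_le.2
    ⟨M, by rintro _ ⟨v, rfl⟩; exact hM v⟩) u 0]

lemma epsilonSign_mul_self (ω : ℂ) : epsilonSign L ω * epsilonSign L ω = 1 := by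
  unfold epsilonSign; split_ifs <;> norm_num

lemma epsilonSign_ne_zero (ω : ℂ) : epsilonSign L ω ≠ 0 := by
  unfold epsilonSign; split_ifs <;> norm_num

lemma brpm_swap (x y : ℂ) : brpm L κ x y = -brpm L κ y x := by
  rw [brpm, brpm, ← neg_sub y x, br_neg, add_comm]; ring

@[simp] lemma brpm_self (x : ℂ) : brpm L κ x x = 0 := by simp [brpm]

lemma brpm_neg_left (x y : ℂ) : brpm L κ (-x) y = brpm L κ x y := by
  rw [brpm, brpm, show -x + y = -(x - y) by ring, show -x - y = -(x + y) by ring, br_neg, br_neg]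
  ring

lemma brpm_eq_zero_iff {x y : ℂ} :
    brpm L κ x y = 0 ↔ x + y ∈ L.lattice ∨ x - y ∈ L.lattice := by
  simp [brpm, br_eq_zero_iff]

/-- The signs square to `1` and `y` cancels from the exponent, so all functions `[x ± y]` of `x`
share one multiplier. -/
lemma brpm_add {ω : ℂ} (hω : ω ∈ L.lattice) (x y : ℂ) :
    brpm L κ (x + ω) y = e (eta L κ ω * (2 * x + ω)) * brpm L κ x y := by
  have h : e (eta L κ ω * (2 * x + ω)) =
      e (eta L κ ω * (x + y + ω / 2)) * e (eta L κ ω * (x - y + ω / 2)) := by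
    rw [← e_add]; congr 1; ring
  rw [brpm, brpm, add_right_comm, add_sub_right_comm, br_add L κ hω, br_add L κ hω, h]
  linear_combination (e (eta L κ ω * (x + y + ω / 2)) * br L κ (x + y) *
    (e (eta L κ ω * (x - y + ω / 2)) * br L κ (x - y))) * epsilonSign_mul_self L ω

lemma differentiable_brpm_left (y : ℂ) : Differentiable ℂ fun x => brpm L κ x y := by
  have := differentiable_br L κ
  unfold brpm; fun_prop

/-- If `x + y` and `x - y` were both periods, so would be their difference `2y`; hence only one
factor vanishes, and it does so simply. -/
lemma deriv_brpm_ne_zero {x y : ℂ} (hy : 2 * y ∉ L.lattice) (h : brpm L κ x y = 0) :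
    deriv (fun x => brpm L κ x y) x ≠ 0 := by
  have hd := differentiable_br L κ
  have e1 : deriv (fun x => brpm L κ x y) x =
      deriv (br L κ) (x + y) * br L κ (x - y) + br L κ (x + y) * deriv (br L κ) (x - y) := by
    unfold brpm
    rw [deriv_fun_mul (by fun_prop) (by fun_prop), deriv_comp_add_const, deriv_comp_sub_const]
  rw [e1]
  rcases (brpm_eq_zero_iff L κ).1 h with h | h
  · have h2 : x - y ∉ L.lattice := fun h' => hy (by
      convert! sub_mem h h' using 1; ring)
    rw [(br_eq_zero_iff L κ).2 h, zero_mul, add_zero]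
    exact mul_ne_zero (deriv_br_ne_zero L κ h) fun h' => h2 ((br_eq_zero_iff L κ).1 h')
  · have h2 : x + y ∉ L.lattice := fun h' => hy (by
      convert! sub_mem h' h using 1; ring)
    rw [(br_eq_zero_iff L κ).2 h, mul_zero, zero_add]
    exact mul_ne_zero (fun h' => h2 ((br_eq_zero_iff L κ).1 h')) (deriv_br_ne_zero L κ h)

/-- As functions of `x`, the first two terms together have the multiplier of `[x ± y]` and vanish at
its simple zeros, so they are a multiple of it. Setting `x = u` finds the constant. -/
lemma three_term_of_generic (x u v y : ℂ) (hy : 2 * y ∉ L.lattice) (hyu : y + u ∉ L.lattice)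
    (hyu' : y - u ∉ L.lattice) :
    brpm L κ x u * brpm L κ v y + brpm L κ x v * brpm L κ y u + brpm L κ x y * brpm L κ u v = 0 := by
  set f : ℂ → ℂ := fun x => brpm L κ x u * brpm L κ v y + brpm L κ x v * brpm L κ y u with hf
  have hfadd : ∀ ω ∈ L.lattice, ∀ x, f (x + ω) = e (eta L κ ω * (2 * x + ω)) * f x := by
    intro ω hω x
    simp only [hf, brpm_add L κ hω]
    ring
  have hfy : f y = 0 := by simp only [hf]; rw [brpm_swap L κ v y]; ring
  have hfneg : ∀ x, f (-x) = f x := fun x => by simp only [hf, brpm_neg_left]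
  obtain ⟨C, hC⟩ := exists_eq_const_mul L (f := f) (g := fun x => brpm L κ x y)
    (by
      have := differentiable_brpm_left L κ
      simp only [hf]; fun_prop)
    (differentiable_brpm_left L κ y)
    (fun x hx => by
      refine ⟨?_, deriv_brpm_ne_zero L κ hy hx⟩
      rcases (brpm_eq_zero_iff L κ).1 hx with h | h
      · have := hfadd _ h (-y)
        rwa [hfneg, hfy, mul_zero, show -y + (x + y) = x by ring] at this
      · have := hfadd _ h y
        rwa [hfy, mul_zero, show y + (x - y) = x by ring] at this)
    (fun ω hω => ⟨fun x => e (eta L κ ω * (2 * x + ω)),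
      by
        have := differentiable_e
        fun_prop,
      fun x => ⟨e_ne_zero _, hfadd ω hω x, brpm_add L κ hω x y⟩⟩)
  have hyu0 : brpm L κ y u ≠ 0 := by
    rw [Ne, brpm_eq_zero_iff]; tauto
  have hu := hC u
  simp only [hf, brpm_self, zero_mul, zero_add] at hu
  rw [brpm_swap L κ u y] at hu
  have hC' : C = -brpm L κ u v := by
    apply mul_right_cancel₀ hyu0
    linear_combination hu
  have := hC x
  rw [hC'] at this
  simp only [hf] at this
  linear_combination this

lemma continuous_br : Continuous (br L κ) := (differentiable_br L κ).continuous

/-- The Weierstrass three-term relation. -/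
theorem three_term (x u v y : ℂ) :
    brpm L κ x u * brpm L κ v y + brpm L κ x v * brpm L κ y u + brpm L κ x y * brpm L κ u v = 0 := by
  -- The exceptional values of `y` are countable, so continuity in `y` covers them.
  have hd : Dense ({y | 2 * y ∈ (L.lattice : Set ℂ)} ∪ {y | y + u ∈ (L.lattice : Set ℂ)} ∪
      {y | y - u ∈ (L.lattice : Set ℂ)})ᶜ := by
    refine Set.Countable.dense_compl ℝ ?_
    have hL := countable_lattice L
    refine ((hL.preimage ?_).union (hL.preimage (f := fun y => y + u) ?_)).union
      (hL.preimage (f := fun y => y - u) ?_)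
    · exact mul_right_injective₀ two_ne_zero
    · exact add_left_injective u
    · exact sub_left_injective
  have hb := continuous_br L κ
  have := Continuous.ext_on hd (f := fun y => brpm L κ x u * brpm L κ v y +
    brpm L κ x v * brpm L κ y u + brpm L κ x y * brpm L κ u v) (g := fun _ => 0)
    (by unfold brpm; fun_prop) continuous_const
    (fun y hy => by
      simp only [Set.mem_compl_iff, Set.mem_union, Set.mem_ofPred_eq, not_or] at hy
      exact three_term_of_generic L κ x u v y hy.1.1 hy.1.2 hy.2)
  exact congr_fun this y

/-- The three-term relation in Plücker form: `[x ± y]` behaves like a `2 × 2` determinant. -/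
lemma brpm_mul_brpm (x y p q : ℂ) :
    brpm L κ x y * brpm L κ p q =
      brpm L κ x p * brpm L κ y q - brpm L κ x q * brpm L κ y p := by
  have := three_term L κ x p q y
  rw [brpm_swap L κ q y] at this
  linear_combination this

end

/-! ### Elliptic partial fractions and the duplication formula -/

section

variable (L : PeriodPair) (κ : ℂ)

/-- A degree-two function of `v` of the form `∑ C_k [X_k ± v]` vanishes identically if it vanishes
at two independent points. -/
lemma sum_mul_brpm_eq_zero {ι : Type*} (s : Finset ι) (C X : ι → ℂ) {p q : ℂ}
    (hpq : brpm L κ p q ≠ 0) (hp : ∑ k ∈ s, C k * brpm L κ (X k) p = 0)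
    (hq : ∑ k ∈ s, C k * brpm L κ (X k) q = 0) (v : ℂ) :
    ∑ k ∈ s, C k * brpm L κ (X k) v = 0 := by
  apply mul_right_cancel₀ hpq
  calc (∑ k ∈ s, C k * brpm L κ (X k) v) * brpm L κ p q
      = ∑ k ∈ s, (C k * brpm L κ (X k) p * brpm L κ v q -
          C k * brpm L κ (X k) q * brpm L κ v p) := by
        rw [Finset.sum_mul]
        refine Finset.sum_congr rfl fun k _ => ?_
        linear_combination C k * brpm_mul_brpm L κ (X k) v p q
    _ = 0 * brpm L κ p q := by
        rw [Finset.sum_sub_distrib, ← Finset.sum_mul, ← Finset.sum_mul, hp, hq]; ring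

/-- The elliptic partial fraction identity (the residue theorem for a product of ratios of sigma
functions with simple poles `x_k` and zeros `y_j`). -/
theorem sum_prod_div_prod_eq_zero {ι τ : Type*} [DecidableEq ι] [DecidableEq τ] (n : ℕ) :
    ∀ (s : Finset ι) (t : Finset τ) (x : ι → ℂ) (y : τ → ℂ), s.card = n → t.card = n →
      ∑ k ∈ s, x k = ∑ j ∈ t, y j →
      (∀ i ∈ s, ∀ j ∈ s, i ≠ j → br L κ (x i - x j) ≠ 0) →
      ∑ k ∈ s, (∏ j ∈ t, br L κ (x k - y j)) / ∏ j ∈ s.erase k, br L κ (x k - x j) = 0 := by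
  induction n with
  | zero =>
    intro s t x y hs
    rw [Finset.card_eq_zero] at hs
    simp [hs]
  | succ n ih =>
    intro s t x y hs ht hsum hne
    rcases n with _ | _ | n
    · obtain ⟨i, rfl⟩ := Finset.card_eq_one.1 hs
      obtain ⟨a, rfl⟩ := Finset.card_eq_one.1 ht
      simp only [Finset.sum_singleton] at hsum
      simp [hsum]
    · obtain ⟨i, j, hij, rfl⟩ := Finset.card_eq_two.1 hs
      obtain ⟨a, b, hab, rfl⟩ := Finset.card_eq_two.1 ht
      rw [Finset.sum_pair hij, Finset.sum_pair hab] at hsum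
      have e1 : ({i, j} : Finset ι).erase i = {j} := by
        ext k; simp only [Finset.mem_erase, Finset.mem_insert, Finset.mem_singleton]; grind
      have e2 : ({i, j} : Finset ι).erase j = {i} := by
        ext k; simp only [Finset.mem_erase, Finset.mem_insert, Finset.mem_singleton]; grind
      rw [Finset.sum_pair hij, Finset.prod_pair hab, Finset.prod_pair hab, e1, e2,
        Finset.prod_singleton, Finset.prod_singleton, ← neg_sub (x i) (x j), br_neg,
        show x j - y a = -(x i - y b) by linear_combination hsum,
        show x j - y b = -(x i - y a) by linear_combination hsum, br_neg, br_neg]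
      have := hne i (by simp) j (by simp) hij
      field_simp
      ring
    -- At least three poles. Keep `S = y_a + y_b` fixed and put `y_a = S/2 + v`, `y_b = S/2 - v`:
    -- the sum becomes a degree-two function of `v`. At `v = x_i - S/2` the zero `y_a` cancels the
    -- pole `x_i`, which leaves the identity with one pole fewer.
    · obtain ⟨a, ha, b, hb, hab⟩ := Finset.one_lt_card.1 (by omega : 1 < t.card)
      set S := y a + y b with hS
      set t₀ := (t.erase a).erase b with ht₀
      have hba : b ∈ t.erase a := Finset.mem_erase.2 ⟨hab.symm, hb⟩
      have hsplit : ∀ f : τ → ℂ, ∏ j ∈ t, f j = f a * (f b * ∏ j ∈ t₀, f j) := fun f => by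
        rw [ht₀, Finset.mul_prod_erase _ f hba, Finset.mul_prod_erase _ f ha]
      set C : ι → ℂ := fun k =>
        (∏ j ∈ t₀, br L κ (x k - y j)) / ∏ j ∈ s.erase k, br L κ (x k - x j) with hC
      have hF : ∀ i ∈ s, ∑ k ∈ s, C k * brpm L κ (x k - S / 2) (x i - S / 2) = 0 := by
        intro i hi
        have hsum' : ∑ j ∈ t, y j = y a + (y b + ∑ j ∈ t₀, y j) := by
          rw [ht₀, Finset.add_sum_erase _ y hba, Finset.add_sum_erase _ y ha]
        have hyt : ∀ j ∈ t₀, Function.update y b (S - x i) j = y j := fun j hj =>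
          Function.update_of_ne (Finset.mem_erase.1 hj).1 _ _
        have := ih (s.erase i) (t.erase a) x (Function.update y b (S - x i))
          (by rw [Finset.card_erase_of_mem hi]; omega)
          (by rw [Finset.card_erase_of_mem ha]; omega)
          (by
            rw [← Finset.add_sum_erase _ _ hba, Finset.sum_congr rfl hyt, Function.update_self]
            have h1 := Finset.add_sum_erase _ x hi
            linear_combination h1 + hsum + hsum')
          (fun k hk j hj => hne k (Finset.mem_of_mem_erase hk) j (Finset.mem_of_mem_erase hj))
        rw [← Finset.add_sum_erase _ _ hi, brpm_self, mul_zero, zero_add, ← this]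
        refine Finset.sum_congr rfl fun k hk => ?_
        obtain ⟨hki, hks⟩ := Finset.mem_erase.1 hk
        have hik : i ∈ s.erase k := Finset.mem_erase.2 ⟨hki.symm, hi⟩
        have h0 := hne k hks i hi hki
        rw [← Finset.mul_prod_erase _ _ hba, Function.update_self,
          Finset.prod_congr rfl fun j hj => by rw [hyt j hj], hC]
        simp only
        rw [← Finset.mul_prod_erase _ _ hik, Finset.erase_right_comm, brpm,
          show x k - S / 2 + (x i - S / 2) = x k - (S - x i) by ring,
          show x k - S / 2 - (x i - S / 2) = x k - x i by ring, ← ht₀]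
        field_simp
      -- If `x_i` were dependent on both `x_j` and `x_k`, then `x_i + x_j - S` and `x_i + x_k - S`
      -- would be periods, hence also `x_j - x_k`. This needs three poles, so the case of two is
      -- treated directly.
      obtain ⟨i, hi, j, hj, hij⟩ : ∃ i ∈ s, ∃ j ∈ s,
          brpm L κ (x i - S / 2) (x j - S / 2) ≠ 0 := by
        obtain ⟨i, j, k, hi, hj, hk, hij, hik, hjk⟩ := Finset.two_lt_card_iff.1
          (by omega : 2 < s.card)
        by_contra! hcon
        have key : ∀ l ∈ s, i ≠ l → x i + x l - S ∈ L.lattice := by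
          intro l hl hil
          have h1 := hcon i hi l hl
          rw [brpm, mul_eq_zero] at h1
          rcases h1 with h1 | h1
          · rw [br_eq_zero_iff] at h1
            convert! h1 using 1; ring
          · refine absurd ?_ (hne i hi l hl hil)
            convert! h1 using 2; ring
        refine hne j hj k hk hjk ((br_eq_zero_iff L κ).2 ?_)
        convert! sub_mem (key j hj hij) (key k hk hik) using 1; ring
      rw [← sum_mul_brpm_eq_zero L κ s C (fun k => x k - S / 2) hij (hF i hi) (hF j hj)
        (y a - S / 2)]
      refine Finset.sum_congr rfl fun k _ => ?_
      rw [hsplit, hC, brpm, show x k - S / 2 + (y a - S / 2) = x k - y b by rw [hS]; ring,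
        show x k - S / 2 - (y a - S / 2) = x k - y a by ring]
      ring

lemma om_mem_lattice (r : Fin 4) : om L r ∈ L.lattice := by
  have h1 := L.ω₁_mem_lattice
  have h2 := L.ω₂_mem_lattice
  fin_cases r
  · exact zero_mem _
  · exact h1
  · exact h2
  · exact sub_mem (neg_mem h1) h2

lemma sum_om : ∑ r, om L r = 0 := by simp [om, Fin.sum_univ_four]

/-- The `om L r` have pairwise different parities of coordinates, so they represent distinct classes
modulo `2Ω`. -/
lemma om_half_sub_notMem {r s : Fin 4} (hrs : r ≠ s) :
    om L r / 2 - om L s / 2 ∉ L.lattice := by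
  intro h
  obtain ⟨m, n, hmn⟩ := PeriodPair.mem_lattice.1 h
  have key : ∀ a b : ℤ, om L r - om L s = a * L.ω₁ + b * L.ω₂ → 2 * m = a ∧ 2 * n = b := by
    intro a b hab
    have := LinearIndependent.pair_iff.mp L.indep (2 * m - a) (2 * n - b) (by
      simp only [Complex.real_smul]
      push_cast
      linear_combination 2 * hmn + hab)
    constructor
    · have := this.1; rw [sub_eq_zero] at this; exact_mod_cast this
    · have := this.2; rw [sub_eq_zero] at this; exact_mod_cast this
  have hom : ∀ t, om L t = ((![0, 1, 0, -1] t : ℤ) : ℂ) * L.ω₁ +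
      ((![0, 0, 1, -1] t : ℤ) : ℂ) * L.ω₂ := by
    intro t
    fin_cases t <;> simp [om]
    ring
  have := key (![0, 1, 0, -1] r - ![0, 1, 0, -1] s) (![0, 0, 1, -1] r - ![0, 0, 1, -1] s) (by
    rw [hom r, hom s]; push_cast; ring)
  revert this hrs
  fin_cases r <;> fin_cases s <;> simp <;> omega

lemma deriv_prod_of_eq_zero {ι : Type*} [DecidableEq ι] {s : Finset ι} {f : ι → ℂ → ℂ} {u : ℂ}
    (hf : ∀ i ∈ s, DifferentiableAt ℂ (f i) u) {j : ι} (hj : j ∈ s) (h0 : f j u = 0) :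
    deriv (fun v => ∏ i ∈ s, f i v) u = deriv (f j) u * ∏ i ∈ s.erase j, f i u := by
  have h : (fun v => ∏ i ∈ s, f i v) = fun v => f j v * ∏ i ∈ s.erase j, f i v :=
    funext fun v => (Finset.mul_prod_erase s (fun i => f i v) hj).symm
  rw [h, deriv_fun_mul (hf j hj)
    (DifferentiableAt.fun_finsetProd fun i hi => hf i (Finset.mem_of_mem_erase hi)), h0]
  ring

lemma br_add_two_mul {ω : ℂ} (hω : ω ∈ L.lattice) (u : ℂ) :
    br L κ (u + 2 * ω) = e (2 * eta L κ ω * (u + ω)) * br L κ u := by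
  have h : e (2 * eta L κ ω * (u + ω)) =
      e (eta L κ ω * (u + ω + ω / 2)) * e (eta L κ ω * (u + ω / 2)) := by
    rw [← e_add]; congr 1; ring
  rw [two_mul, ← add_assoc, br_add L κ hω, br_add L κ hω, h]
  linear_combination (e (eta L κ ω * (u + ω + ω / 2)) * e (eta L κ ω * (u + ω / 2)) * br L κ u) *
    epsilonSign_mul_self L ω

/-- The duplication formula, up to the value of the constant. -/
theorem exists_br_two_mul : ∃ C : ℂ, ∀ u, br L κ (2 * u) = C * ∏ s, br L κ (u - om L s / 2) := by
  have hd := differentiable_br L κ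
  refine exists_eq_const_mul L (f := fun u => br L κ (2 * u))
    (g := fun u => ∏ s, br L κ (u - om L s / 2)) (by fun_prop) (by fun_prop) ?_ ?_
  · intro u hu
    obtain ⟨s, -, hs⟩ := Finset.prod_eq_zero_iff.1 hu
    have hs' := (br_eq_zero_iff L κ).1 hs
    constructor
    · rw [br_eq_zero_iff]
      convert! add_mem (add_mem hs' hs') (om_mem_lattice L s) using 1; ring
    · rw [deriv_prod_of_eq_zero (f := fun s u => br L κ (u - om L s / 2))
        (fun i _ => by fun_prop) (Finset.mem_univ s) hs]
      refine mul_ne_zero ?_ (Finset.prod_ne_zero_iff.2 fun r hr => ?_)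
      · rw [deriv_comp_sub_const]
        exact deriv_br_ne_zero L κ hs'
      · rw [Ne, br_eq_zero_iff]
        intro h
        refine om_half_sub_notMem L (Finset.ne_of_mem_erase hr) ?_
        convert! sub_mem hs' h using 1; ring
  · intro ω hω
    -- The common multiplier carries no sign, since `ε` enters to an even power on both sides; on
    -- the right the half periods drop out of the exponent because they sum to zero.
    refine ⟨fun u => e (2 * eta L κ ω * (2 * u + ω)), ?_, fun u => ⟨e_ne_zero _, ?_, ?_⟩⟩
    · have := differentiable_e
      fun_prop
    · rw [mul_add, br_add_two_mul L κ hω]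
    · have h1 : ∀ s, br L κ (u + ω - om L s / 2) = epsilonSign L ω *
          e (eta L κ ω * (u - om L s / 2 + ω / 2)) * br L κ (u - om L s / 2) := fun s => by
        rw [add_sub_right_comm, br_add L κ hω]
      have h2 : e (2 * eta L κ ω * (2 * u + ω)) =
          ∏ s, e (eta L κ ω * (u - om L s / 2 + ω / 2)) := by
        have h3 := sum_om L
        rw [Fin.sum_univ_four] at h3
        rw [Fin.prod_univ_four, ← e_add, ← e_add, ← e_add]
        congr 1
        linear_combination (eta L κ ω / 2) * h3
      simp only [h1]
      rw [Finset.prod_mul_distrib, Finset.prod_mul_distrib, h2, Finset.prod_const,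
        Finset.card_univ, Fintype.card_fin, pow_mul (epsilonSign L ω) 2 2, pow_two (epsilonSign L ω),
        epsilonSign_mul_self, one_pow, one_mul]

/-- The constant of the duplication formula. -/
lemma mul_prod_om_half {C : ℂ} (hC : ∀ u, br L κ (2 * u) = C * ∏ s, br L κ (u - om L s / 2))
    (s : Fin 4) :
    C * ∏ r ∈ Finset.univ.erase s, br L κ (om L s / 2 - om L r / 2) =
      2 * (epsilonSign L (om L s) * e (eta L κ (om L s) * (om L s / 2))) := by
  have hd := differentiable_br L κ
  -- Both sides of the duplication formula vanish at `om L s / 2`; comparing derivatives there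
  -- determines the product.
  have h1 : deriv (fun u => br L κ (2 * u)) (om L s / 2) =
      C * deriv (fun u => ∏ s, br L κ (u - om L s / 2)) (om L s / 2) := by
    rw [← deriv_const_mul _ (by fun_prop)]
    exact congr_arg (fun f => deriv f (om L s / 2)) (funext hC)
  rw [deriv_prod_of_eq_zero (f := fun s u => br L κ (u - om L s / 2))
    (fun i _ => by fun_prop) (Finset.mem_univ s) (by simp), deriv_comp_sub_const, sub_self,
    deriv_br_zero, one_mul, deriv_comp_mul_left, mul_div_cancel₀ _ (two_ne_zero)] at h1
  have h2 := deriv_br_add L κ (ω := om L s) (η := eta L κ (om L s))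
    (C := epsilonSign L (om L s) * e (eta L κ (om L s) * (om L s / 2))) (fun u => by
      rw [br_add L κ (om_mem_lattice L s), mul_add, e_add]; ring) (br_zero L κ)
  rw [zero_add, deriv_br_zero, mul_zero, e_zero] at h2
  rw [← h1, h2, smul_eq_mul]
  ring

end

/-! ### The kernel identity in one pair of variables -/

section

variable (L : PeriodPair) (κ : ℂ)

/-- The arguments for `a_p` and `b_p` add up to `om L r`, so oddness and quasi-periodicity relate
the factors. The eight signs cancel, and the exponentials multiply to `1` by the balancing
condition. -/
lemma AZeroTerm_dual {δ : ℂ} {a b : Fin 8 → ℂ} (hb : ∀ p, b p = δ - a p)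
    (ha : ∑ p, a p = 4 * δ) (r : Fin 4) (c x : ℂ) :
    AZeroTerm L κ δ b r c x = AZeroTerm L κ δ a r c x := by
  have hω := om_mem_lattice L r
  have hsum : ∑ p, b p = ∑ p, a p := by
    simp only [hb, Finset.sum_sub_distrib, ha]
    simp
    ring
  have hprod : ∏ p, br L κ ((om L r - δ) / 2 + b p) = ∏ p, br L κ ((om L r - δ) / 2 + a p) := by
    have h1 : ∀ p, br L κ ((om L r - δ) / 2 + a p) = epsilonSign L (om L r) *
        e (eta L κ (om L r) * ((om L r - δ) / 2 + a p - om L r / 2)) *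
          -br L κ ((om L r - δ) / 2 + b p) := by
      intro p
      have := br_add L κ hω ((om L r - δ) / 2 + a p - om L r)
      rw [sub_add_cancel] at this
      rw [this, ← br_neg, hb]
      congr 2
      · congr 2; ring
      · ring
    have h2 : ∏ p, e (eta L κ (om L r) * ((om L r - δ) / 2 + a p - om L r / 2)) = 1 := by
      have : ∀ s : Finset (Fin 8), ∀ f : Fin 8 → ℂ, ∏ p ∈ s, e (f p) = e (∑ p ∈ s, f p) := by
        intro s f
        induction s using Finset.induction_on with
        | empty => simp
        | insert i s hi ih => rw [Finset.prod_insert hi, Finset.sum_insert hi, e_add, ih]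
      rw [this, ← Finset.mul_sum, Finset.sum_sub_distrib, Finset.sum_add_distrib, ha]
      simp only [Finset.sum_const, Finset.card_univ, Fintype.card_fin, nsmul_eq_mul]
      rw [← e_zero]
      congr 1
      push_cast
      ring
    have hε : epsilonSign L (om L r) ^ 8 = 1 := by
      rw [pow_mul _ 2 4, pow_two, epsilonSign_mul_self, one_pow]
    have h3 : ∏ p : Fin 8, -br L κ ((om L r - δ) / 2 + b p) =
        ∏ p : Fin 8, br L κ ((om L r - δ) / 2 + b p) := by
      rw [Finset.prod_neg]
      norm_num
    simp only [h1]
    rw [Finset.prod_mul_distrib, Finset.prod_mul_distrib, h2, h3, Finset.prod_const,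
      Finset.card_univ, Fintype.card_fin 8, hε]
    ring
  unfold AZeroTerm
  rw [hsum, hprod]

lemma AZero_dual {δ : ℂ} {a b : Fin 8 → ℂ} (hb : ∀ p, b p = δ - a p)
    (ha : ∑ p, a p = 4 * δ) (c : Fin 4 → ℂ) (x : ℂ) :
    AZero L κ δ b c x = AZero L κ δ a c x :=
  Finset.sum_congr rfl fun r _ => AZeroTerm_dual L κ hb ha r (c r) x

lemma prod_erase_inl {α β : Type*} [Fintype α] [Fintype β] [DecidableEq α] [DecidableEq β]
    (f : α ⊕ β → ℂ) (i : α) :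
    ∏ j ∈ Finset.univ.erase (Sum.inl i), f j =
      (∏ j ∈ Finset.univ.erase i, f (Sum.inl j)) * ∏ j, f (Sum.inr j) := by
  rw [← Finset.prod_disjSum]
  refine Finset.prod_congr ?_ fun _ _ => rfl
  ext (j | j) <;> simp

lemma prod_erase_inr {α β : Type*} [Fintype α] [Fintype β] [DecidableEq α] [DecidableEq β]
    (f : α ⊕ β → ℂ) (i : β) :
    ∏ j ∈ Finset.univ.erase (Sum.inr i), f j =
      (∏ j, f (Sum.inl j)) * ∏ j ∈ Finset.univ.erase i, f (Sum.inr j) := by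
  rw [← Finset.prod_disjSum]
  refine Finset.prod_congr ?_ fun _ _ => rfl
  ext (j | j) <;> simp

lemma prod_erase_fin_four (f : Fin 4 → ℂ) :
    (∏ j ∈ Finset.univ.erase 0, f j = f 1 * f 2 * f 3) ∧
    (∏ j ∈ Finset.univ.erase 1, f j = f 0 * f 2 * f 3) ∧
    (∏ j ∈ Finset.univ.erase 2, f j = f 0 * f 1 * f 3) ∧
    (∏ j ∈ Finset.univ.erase 3, f j = f 0 * f 1 * f 2) := by
  have h0 : (Finset.univ.erase 0 : Finset (Fin 4)) = {1, 2, 3} := by decide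
  have h1 : (Finset.univ.erase 1 : Finset (Fin 4)) = {0, 2, 3} := by decide
  have h2 : (Finset.univ.erase 2 : Finset (Fin 4)) = {0, 1, 3} := by decide
  have h3 : (Finset.univ.erase 3 : Finset (Fin 4)) = {0, 1, 2} := by decide
  rw [h0, h1, h2, h3]
  simp [mul_assoc]

/-- The three-term relation extracts `[z ± w]` and eliminates `c`: the parameter changes the
potential only by a constant. -/
lemma AZeroTerm_sub {δ : ℂ} (a : Fin 8 → ℂ) (r : Fin 4) {c z w : ℂ}
    (hz : brpm L κ ((om L r - δ) / 2) z ≠ 0) (hw : brpm L κ ((om L r - δ) / 2) w ≠ 0)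
    (hc : brpm L κ ((om L r - δ) / 2) c ≠ 0) :
    AZeroTerm L κ δ a r c z - AZeroTerm L κ δ a r c w =
      brpm L κ z w * (epsilonSign L (om L r) *
        e ((δ - om L r / 2 - (∑ p, a p) / 2) * eta L κ (om L r)) *
        ∏ p, br L κ ((om L r - δ) / 2 + a p)) /
          (2 * brpm L κ ((om L r - δ) / 2) z * brpm L κ ((om L r - δ) / 2) w) := by
  have key := three_term L κ z c ((om L r - δ) / 2) w
  rw [brpm_swap L κ z ((om L r - δ) / 2), brpm_swap L κ c ((om L r - δ) / 2)] at key
  unfold AZeroTerm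
  generalize brpm L κ ((om L r - δ) / 2) z = qz at *
  generalize brpm L κ ((om L r - δ) / 2) w = qw at *
  generalize brpm L κ ((om L r - δ) / 2) c = qc at *
  generalize ∏ p, br L κ ((om L r - δ) / 2 + a p) = P
  generalize epsilonSign L (om L r) = ε
  generalize e ((δ - om L r / 2 - (∑ p, a p) / 2) * eta L κ (om L r)) = E
  field_simp
  linear_combination (ε * E * P) * key

/-- The duality for one variable. -/
theorem kernel_duality {δ : ℂ} {a b : Fin 8 → ℂ} (hb : ∀ p, b p = δ - a p)
    (ha : ∑ p, a p = 4 * δ) {c : Fin 4 → ℂ} {N : ℕ} {Z W : Fin N → ℂ}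
    (hZ : NonDegenerate L κ δ c Z W) (hW : NonDegenerate L κ δ c W Z) (i k : Fin N)
    (hzw : brpm L κ (Z i) (W k) ≠ 0) :
    APlus L κ δ a (Z i) / brpm L κ (Z i + δ) (W k) +
        AMinus L κ δ a (Z i) / brpm L κ (Z i - δ) (W k) +
        AZero L κ δ a c (Z i) / brpm L κ (Z i) (W k) =
      -(APlus L κ δ b (W k) / brpm L κ (W k + δ) (Z i) +
        AMinus L κ δ b (W k) / brpm L κ (W k - δ) (Z i) +
        AZero L κ δ b c (W k) / brpm L κ (W k) (Z i)) := by
  have z2 := hZ.two_mul_ne i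
  have z2p := hZ.two_mul_add_ne i
  have z2m := hZ.two_mul_sub_ne i
  have zh := fun r => hZ.half_ne r i
  have w2 := hW.two_mul_ne k
  have w2p := hW.two_mul_add_ne k
  have w2m := hW.two_mul_sub_ne k
  have wh := fun r => hW.half_ne r k
  have ch := hZ.half_c_ne
  have zwp := hZ.add_ne i k
  have zwm := hZ.sub_ne i k
  have wzp := hW.add_ne k i
  have wzm := hW.sub_ne k i
  rw [AZero_dual L κ hb ha]
  generalize Z i = z at *
  generalize W k = w at *
  obtain ⟨C, hC⟩ := exists_br_two_mul L κ
  have hC0 : C ≠ 0 := by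
    rintro rfl
    exact z2 (by rw [hC, zero_mul])
  have hdup : ∀ u, ∏ s, br L κ (u - om L s / 2) = br L κ (2 * u) / C := fun u => by
    rw [hC]; field_simp
  -- These four poles have sum zero, as have the half periods. The product over the half periods
  -- collapses to `[2u] / C` by duplication, which supplies the denominators `[2x ± δ]` of `A⁺` and
  -- `A⁻`.
  set X : Fin 4 → ℂ := ![z + δ / 2, -z + δ / 2, w - δ / 2, -w - δ / 2] with hX
  set x : Fin 4 ⊕ Fin 4 → ℂ := Sum.elim X fun s => om L s / 2 with hx
  have hhalf : ∀ s, ∏ j, br L κ (om L s / 2 - X j) =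
      brpm L κ ((om L s - δ) / 2) z *
        (e (eta L κ (om L s) * δ) * brpm L κ ((om L s - δ) / 2) w) := by
    -- The two `w`-factors sit at `(om L s + δ) / 2`; the period shift back to `(om L s - δ) / 2`
    -- produces the exponential.
    intro s
    have h1 := brpm_add L κ (om_mem_lattice L s) (-((om L s - δ) / 2)) w
    rw [brpm_neg_left, show 2 * -((om L s - δ) / 2) + om L s = δ by ring] at h1
    rw [← h1, Fin.prod_univ_four, brpm, brpm]
    simp only [hX, Matrix.cons_val]
    rw [show om L s / 2 - (z + δ / 2) = (om L s - δ) / 2 - z by ring,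
      show om L s / 2 - (-z + δ / 2) = (om L s - δ) / 2 + z by ring,
      show om L s / 2 - (w - δ / 2) = -((om L s - δ) / 2) + om L s - w by ring,
      show om L s / 2 - (-w - δ / 2) = -((om L s - δ) / 2) + om L s + w by ring]
    ring
  have hXX : ∀ i j, i ≠ j → br L κ (X i - X j) ≠ 0 := by
    have hs : ∀ i j, br L κ (X i - X j) ≠ 0 → br L κ (X j - X i) ≠ 0 := by
      intro i j h
      rw [← neg_sub, br_neg]; exact neg_ne_zero.2 h
    have h01 : br L κ (X 0 - X 1) ≠ 0 := by
      convert! z2 using 2; simp [hX]; ring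
    have h23 : br L κ (X 2 - X 3) ≠ 0 := by
      convert! w2 using 2; simp [hX]; ring
    have h02 : br L κ (X 0 - X 2) ≠ 0 := by
      convert! right_ne_zero_of_mul zwp using 2; simp [hX]; ring
    have h03 : br L κ (X 0 - X 3) ≠ 0 := by
      convert! left_ne_zero_of_mul zwp using 2; simp [hX]; ring
    have h12 : br L κ (X 1 - X 2) ≠ 0 := by
      rw [← neg_ne_zero, ← br_neg]
      convert! left_ne_zero_of_mul zwm using 2; simp [hX]; ring
    have h13 : br L κ (X 1 - X 3) ≠ 0 := by
      rw [← neg_ne_zero, ← br_neg]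
      convert! right_ne_zero_of_mul zwm using 2; simp [hX]; ring
    intro i j hij
    fin_cases i <;> fin_cases j <;> first | exact absurd rfl hij | assumption | (apply hs; assumption)
  have hdist : ∀ i ∈ Finset.univ, ∀ j ∈ Finset.univ, i ≠ j → br L κ (x i - x j) ≠ 0 := by
    have hXs : ∀ i s, br L κ (om L s / 2 - X i) ≠ 0 := by
      intro i s h
      have h1 := Finset.prod_eq_zero (f := fun j => br L κ (om L s / 2 - X j)) (Finset.mem_univ i) h
      rw [hhalf] at h1
      exact mul_ne_zero (zh s) (mul_ne_zero (e_ne_zero _) (wh s)) h1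
    rintro (i | i) - (j | j) - hij
    · exact hXX i j fun h => hij (by rw [h])
    · simp only [hx, Sum.elim_inl, Sum.elim_inr]
      rw [← neg_sub, br_neg]; exact neg_ne_zero.2 (hXs i j)
    · exact hXs j i
    · simp only [hx, Sum.elim_inr]
      rw [Ne, br_eq_zero_iff]
      exact om_half_sub_notMem L fun h => hij (by rw [h])
  have main := sum_prod_div_prod_eq_zero L κ 8 Finset.univ Finset.univ x (fun p => δ / 2 - a p)
    (by simp) (by simp)
    (by
      have h3 := sum_om L
      rw [Fin.sum_univ_four] at h3
      rw [Fintype.sum_sum_type, Finset.sum_sub_distrib, ha]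
      simp only [hx, hX, Sum.elim_inl, Sum.elim_inr, Fin.sum_univ_four, Matrix.cons_val,
        Finset.sum_const, Finset.card_univ, Fintype.card_fin, nsmul_eq_mul]
      push_cast
      linear_combination h3 / 2) hdist
  have T0 : (∏ p, br L κ (x (.inl 0) - (δ / 2 - a p))) /
      ∏ j ∈ Finset.univ.erase (.inl 0), br L κ (x (.inl 0) - x j) =
      C * (APlus L κ δ a z / brpm L κ (z + δ) w) := by
    rw [prod_erase_inl, (prod_erase_fin_four _).1]
    simp only [hx, Sum.elim_inl, Sum.elim_inr, hdup, hX, Matrix.cons_val, APlus, brpm]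
    rw [show z + δ / 2 - (-z + δ / 2) = 2 * z by ring,
      show z + δ / 2 - (w - δ / 2) = z + δ - w by ring,
      show z + δ / 2 - (-w - δ / 2) = z + δ + w by ring,
      show 2 * (z + δ / 2) = 2 * z + δ by ring,
      Finset.prod_congr rfl fun p _ => by
        rw [show z + δ / 2 - (δ / 2 - a p) = z + a p by ring]]
    field_simp
  have T1 : (∏ p, br L κ (x (.inl 1) - (δ / 2 - a p))) /
      ∏ j ∈ Finset.univ.erase (.inl 1), br L κ (x (.inl 1) - x j) =
      C * (AMinus L κ δ a z / brpm L κ (z - δ) w) := by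
    rw [prod_erase_inl, (prod_erase_fin_four _).2.1]
    simp only [hx, Sum.elim_inl, Sum.elim_inr, hdup, hX, Matrix.cons_val, AMinus, brpm]
    rw [show -z + δ / 2 - (z + δ / 2) = -(2 * z) by ring,
      show -z + δ / 2 - (w - δ / 2) = -(z - δ + w) by ring,
      show -z + δ / 2 - (-w - δ / 2) = -(z - δ - w) by ring,
      show 2 * (-z + δ / 2) = -(2 * z - δ) by ring,
      Finset.prod_congr rfl fun p _ => by
        rw [show -z + δ / 2 - (δ / 2 - a p) = -(z - a p) by ring, br_neg],
      Finset.prod_neg, br_neg, br_neg, br_neg, br_neg]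
    norm_num
    field_simp
  have T2 : (∏ p, br L κ (x (.inl 2) - (δ / 2 - a p))) /
      ∏ j ∈ Finset.univ.erase (.inl 2), br L κ (x (.inl 2) - x j) =
      C * (AMinus L κ δ b w / brpm L κ (w - δ) z) := by
    rw [prod_erase_inl, (prod_erase_fin_four _).2.2.1]
    simp only [hx, Sum.elim_inl, Sum.elim_inr, hdup, hX, Matrix.cons_val, AMinus, brpm, hb]
    rw [show w - δ / 2 - (z + δ / 2) = w - δ - z by ring,
      show w - δ / 2 - (-z + δ / 2) = w - δ + z by ring,
      show w - δ / 2 - (-w - δ / 2) = 2 * w by ring,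
      show 2 * (w - δ / 2) = 2 * w - δ by ring,
      Finset.prod_congr rfl fun p _ => by
        rw [show w - δ / 2 - (δ / 2 - a p) = w - (δ - a p) by ring]]
    field_simp
  have T3 : (∏ p, br L κ (x (.inl 3) - (δ / 2 - a p))) /
      ∏ j ∈ Finset.univ.erase (.inl 3), br L κ (x (.inl 3) - x j) =
      C * (APlus L κ δ b w / brpm L κ (w + δ) z) := by
    rw [prod_erase_inl, (prod_erase_fin_four _).2.2.2]
    simp only [hx, Sum.elim_inl, Sum.elim_inr, hdup, hX, Matrix.cons_val, APlus, brpm, hb]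
    rw [show -w - δ / 2 - (z + δ / 2) = -(w + δ + z) by ring,
      show -w - δ / 2 - (-z + δ / 2) = -(w + δ - z) by ring,
      show -w - δ / 2 - (w - δ / 2) = -(2 * w) by ring,
      show 2 * (-w - δ / 2) = -(2 * w + δ) by ring,
      Finset.prod_congr rfl fun p _ => by
        rw [show -w - δ / 2 - (δ / 2 - a p) = -(w + (δ - a p)) by ring, br_neg],
      Finset.prod_neg, br_neg, br_neg, br_neg, br_neg]
    norm_num
    field_simp
  have H : ∀ s, (∏ p, br L κ (x (.inr s) - (δ / 2 - a p))) /
      ∏ j ∈ Finset.univ.erase (.inr s), br L κ (x (.inr s) - x j) =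
      C * ((AZeroTerm L κ δ a s (c s) z - AZeroTerm L κ δ a s (c s) w) / brpm L κ z w) := by
    intro s
    have hQ := mul_prod_om_half L κ hC s
    rw [prod_erase_inr, AZeroTerm_sub L κ a s (zh s) (wh s) (ch s), ha]
    simp only [hx, Sum.elim_inl, Sum.elim_inr]
    rw [hhalf, Finset.prod_congr rfl fun p _ => by
        rw [show om L s / 2 - (δ / 2 - a p) = (om L s - δ) / 2 + a p by ring],
      show (δ - om L s / 2 - 4 * δ / 2) * eta L κ (om L s) =
        -(eta L κ (om L s) * δ + eta L κ (om L s) * (om L s / 2)) by ring, e_neg, e_add]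
    have hzs := zh s
    have hws := wh s
    have hE1 := e_ne_zero (eta L κ (om L s) * δ)
    have hE2 := e_ne_zero (eta L κ (om L s) * (om L s / 2))
    have hε := epsilonSign_mul_self L (om L s)
    have hε0 := epsilonSign_ne_zero L (om L s)
    generalize e (eta L κ (om L s) * δ) = E1 at *
    generalize e (eta L κ (om L s) * (om L s / 2)) = E2 at *
    generalize epsilonSign L (om L s) = ε at *
    rw [show ∏ r ∈ Finset.univ.erase s, br L κ (om L s / 2 - om L r / 2) = 2 * (ε * E2) / C by
      rw [← hQ]; field_simp]
    generalize ∏ p, br L κ ((om L s - δ) / 2 + a p) = P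
    field_simp
    linear_combination -P * hε
  rw [Fintype.sum_sum_type, Fin.sum_univ_four, T0, T1, T2, T3, Finset.sum_congr rfl fun s _ => H s,
    ← Finset.mul_sum, ← Finset.sum_div, Finset.sum_sub_distrib] at main
  have main' := mul_left_cancel₀ hC0 ((mul_zero C).symm ▸
    (show C * (APlus L κ δ a z / brpm L κ (z + δ) w + AMinus L κ δ a z / brpm L κ (z - δ) w +
      AMinus L κ δ b w / brpm L κ (w - δ) z + APlus L κ δ b w / brpm L κ (w + δ) z +
      (AZero L κ δ a c z - AZero L κ δ a c w) / brpm L κ z w) = 0 by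
        rw [← main]; unfold AZero; ring))
  rw [brpm_swap L κ w z, div_neg]
  linear_combination main'

end

/-! ### The elliptic Cauchy determinant and the generating function -/

section

variable (L : PeriodPair) (κ : ℂ)

/-- The Plücker relation with the fixed independent pair `p = ω₁/2`, `q = 0`. -/
lemma exists_brpm_eq_mul_sub_mul :
    ∃ g h : ℂ → ℂ, ∀ x y, brpm L κ x y = g x * h y - h x * g y := by
  have h0 : brpm L κ (L.ω₁ / 2) 0 ≠ 0 := by
    rw [Ne, brpm_eq_zero_iff]
    simp [L.ω₁_div_two_notMem_lattice]
  refine ⟨fun x => brpm L κ x (L.ω₁ / 2) / brpm L κ (L.ω₁ / 2) 0, fun x => brpm L κ x 0,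
    fun x y => ?_⟩
  have := brpm_mul_brpm L κ x y (L.ω₁ / 2) 0
  field_simp
  linear_combination this

/-- The product is homogeneous in `(a, b)`; what matters is that the coefficients do not depend on
`a` and `b`. -/
lemma exists_prod_sub_eq_sum {ι : Type*} (s : Finset ι) (α β : ι → ℂ) :
    ∃ c : ℕ → ℂ, ∀ a b : ℂ, ∏ l ∈ s, (a * α l - b * β l) =
      ∑ m ∈ Finset.range (s.card + 1), b ^ m * a ^ (s.card - m) * c m := by
  classical
  refine ⟨fun m => ∑ t ∈ s.powersetCard m, (∏ l ∈ t, -β l) * ∏ l ∈ s \ t, α l, fun a b => ?_⟩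
  have h1 : ∏ l ∈ s, (a * α l - b * β l) = ∏ l ∈ s, (b * -β l + a * α l) :=
    Finset.prod_congr rfl fun l _ => by ring
  rw [h1, Finset.prod_add, Finset.sum_powerset]
  refine Finset.sum_congr rfl fun m _ => ?_
  rw [Finset.mul_sum]
  refine Finset.sum_congr rfl fun t ht => ?_
  obtain ⟨hts, hm⟩ := Finset.mem_powersetCard.1 ht
  rw [Finset.prod_mul_distrib, Finset.prod_mul_distrib, Finset.prod_const, Finset.prod_const,
    Finset.card_sdiff_of_subset hts, hm]
  ring

/-- The elliptic Cauchy determinant of type `C`, up to a factor that depends on one set of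
variables only. -/
theorem exists_det_cauchy {N : ℕ} (w : Fin N → ℂ)
    (hw : ∀ i j, i ≠ j → brpm L κ (w i) (w j) ≠ 0) :
    ∃ C : ℂ, C ≠ 0 ∧ ∀ X : Fin N → ℂ, (∀ i k, brpm L κ (X i) (w k) ≠ 0) →
      (Matrix.of fun i k => 1 / brpm L κ (X i) (w k)).det =
        C * (∏ i, ∏ j ∈ Finset.Ioi i, brpm L κ (X i) (X j)) /
          ∏ i, ∏ k, brpm L κ (X i) (w k) := by
  obtain ⟨g, h, hgh⟩ := exists_brpm_eq_mul_sub_mul L κ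
  choose c hc using fun k : Fin N =>
    exists_prod_sub_eq_sum (Finset.univ.erase k) (fun l => h (w l)) (fun l => g (w l))
  set A : Matrix (Fin N) (Fin N) ℂ := .of fun m k => c k m with hA
  -- With row denominators cleared, each entry is homogeneous of degree `N - 1` in `(g, h)` at `X
  -- i`. The matrix therefore factors as a projective Vandermonde matrix in `X` times a matrix
  -- depending on `w` alone.
  have hM : ∀ X : Fin N → ℂ,
      (Matrix.of fun i k => ∏ l ∈ Finset.univ.erase k, brpm L κ (X i) (w l)) =
        Matrix.projVandermonde (h ∘ X) (g ∘ X) * A := by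
    intro X
    ext i k
    have hcard : (Finset.univ.erase k).card + 1 = N := by
      rw [Finset.card_erase_add_one (Finset.mem_univ k)]; simp
    have hrange : ∀ f : ℕ → ℂ, ∑ m ∈ Finset.range ((Finset.univ.erase k).card + 1), f m =
        ∑ m : Fin N, f m := fun f => by rw [hcard, Finset.sum_range]
    simp only [Matrix.of_apply, Matrix.mul_apply, Matrix.projVandermonde_apply, hgh, hc, hA,
      Function.comp_apply]
    rw [hrange]
    refine Finset.sum_congr rfl fun m _ => ?_
    rw [Fin.val_rev, show (Finset.univ.erase k).card - m = N - (m + 1) by omega]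
  have hdet : ∀ X : Fin N → ℂ,
      (Matrix.of fun i k => ∏ l ∈ Finset.univ.erase k, brpm L κ (X i) (w l)).det =
        (∏ i, ∏ j ∈ Finset.Ioi i, brpm L κ (X i) (X j)) * A.det := by
    intro X
    rw [hM, Matrix.det_mul, Matrix.det_projVandermonde]
    congr 1
    refine Finset.prod_congr rfl fun i _ => Finset.prod_congr rfl fun j _ => ?_
    rw [hgh, Function.comp_apply, Function.comp_apply, Function.comp_apply, Function.comp_apply]
    ring
  refine ⟨A.det, fun hA0 => ?_, fun X hX => ?_⟩
  -- At `X = w` the cleared matrix is diagonal with nonzero diagonal, which forces `A.det ≠ 0`.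
  · have h1 : (Matrix.of fun i k => ∏ l ∈ Finset.univ.erase k, brpm L κ (w i) (w l)) =
        Matrix.diagonal fun i => ∏ l ∈ Finset.univ.erase i, brpm L κ (w i) (w l) := by
      ext i k
      rcases eq_or_ne i k with rfl | hik
      · simp
      · rw [Matrix.diagonal_apply_ne _ hik, Matrix.of_apply]
        exact Finset.prod_eq_zero (Finset.mem_erase.2 ⟨hik, Finset.mem_univ _⟩) (brpm_self L κ _)
    have h2 := hdet w
    rw [h1, Matrix.det_diagonal, hA0, mul_zero] at h2
    refine Finset.prod_ne_zero_iff.2 (fun i _ => ?_) h2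
    exact Finset.prod_ne_zero_iff.2 fun l hl => hw i l (Finset.ne_of_mem_erase hl).symm
  · have h1 : (Matrix.of fun i k => 1 / brpm L κ (X i) (w k)) = Matrix.of fun i k =>
        (∏ l, brpm L κ (X i) (w l))⁻¹ *
          (Matrix.of fun i k => ∏ l ∈ Finset.univ.erase k, brpm L κ (X i) (w l)) i k := by
      ext i k
      simp only [Matrix.of_apply]
      rw [← Finset.mul_prod_erase _ _ (Finset.mem_univ k), mul_inv_rev]
      have h2 : ∏ l ∈ Finset.univ.erase k, brpm L κ (X i) (w l) ≠ 0 :=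
        Finset.prod_ne_zero_iff.2 fun l _ => hX i l
      have h3 := hX i k
      field_simp
    rw [h1, Matrix.det_mul_column, hdet, Finset.prod_inv_distrib]
    ring

/-- The shift attached to each of the four states of a variable: outside `I`, in `I₀`, in `I₊`,
in `I₋`. -/
def stateShift (δ : ℂ) : Fin 4 → ℂ := ![0, 0, δ, -δ]

/-- The coefficient attached to each of the four states of a variable `x`. -/
def stateCoeff (δ : ℂ) (a : Fin 8 → ℂ) (c : Fin 4 → ℂ) (T x : ℂ) : Fin 4 → ℂ :=
  ![1, T * AZero L κ δ a c x, T * APlus L κ δ a x, T * AMinus L κ δ a x]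

/-- The contribution of a configuration of states, in factorized form. -/
def stateTerm (δ : ℂ) (a : Fin 8 → ℂ) (c : Fin 4 → ℂ) {N : ℕ} (z w : Fin N → ℂ) (T : ℂ)
    (s : Fin N → Fin 4) : ℂ :=
  (∏ i, stateCoeff L κ δ a c T (z i) (s i)) *
    (∏ i, ∏ j ∈ Finset.Ioi i, brpm L κ (z i + stateShift δ (s i)) (z j + stateShift δ (s j)) /
      brpm L κ (z i) (z j)) *
    ∏ i, ∏ k, brpm L κ (z i) (w k) / brpm L κ (z i + stateShift δ (s i)) (w k)

/-- The matrix whose determinant is the generating function. -/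
def kernelMatrix (δ : ℂ) (a : Fin 8 → ℂ) (c : Fin 4 → ℂ) {N : ℕ} (z w : Fin N → ℂ) (T : ℂ) :
    Matrix (Fin N) (Fin N) ℂ :=
  .of fun i k => ∑ σ, stateCoeff L κ δ a c T (z i) σ / brpm L κ (z i + stateShift δ σ) (w k)

/-- The Cauchy matrix. -/
def cauchyMatrix {N : ℕ} (z w : Fin N → ℂ) : Matrix (Fin N) (Fin N) ℂ :=
  .of fun i k => 1 / brpm L κ (z i) (w k)

variable {δ : ℂ} {a b : Fin 8 → ℂ} {c : Fin 4 → ℂ} {N : ℕ} {z w : Fin N → ℂ}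

lemma det_cauchyMatrix_ne_zero (hz : NonDegenerate L κ δ c z w) (hw : NonDegenerate L κ δ c w z)
    (hzw : ∀ i k, brpm L κ (z i) (w k) ≠ 0) : (cauchyMatrix L κ z w).det ≠ 0 := by
  obtain ⟨C, hC, h⟩ := exists_det_cauchy L κ w hw.pair_ne
  rw [cauchyMatrix, h z hzw]
  refine div_ne_zero (mul_ne_zero hC ?_) ?_
  · exact Finset.prod_ne_zero_iff.2 fun i _ => Finset.prod_ne_zero_iff.2 fun j hj =>
      hz.pair_ne i j (Finset.mem_Ioi.1 hj).ne
  · exact Finset.prod_ne_zero_iff.2 fun i _ => Finset.prod_ne_zero_iff.2 fun k _ => hzw i k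

lemma brpm_add_stateShift_ne_zero (hz : NonDegenerate L κ δ c z w)
    (hzw : ∀ i k, brpm L κ (z i) (w k) ≠ 0) (i k : Fin N) (σ : Fin 4) :
    brpm L κ (z i + stateShift δ σ) (w k) ≠ 0 := by
  have h1 := hzw i k
  have h2 := hz.add_ne i k
  have h3 := hz.sub_ne i k
  fin_cases σ
  · simpa [stateShift] using h1
  · simpa [stateShift] using h1
  · simpa [stateShift] using h2
  · simpa [stateShift, ← sub_eq_add_neg] using h3

/-- Multilinearity in the rows selects a state for each variable and leaves a Cauchy determinant at
shifted points. The unspecified constant depends on `w` only and cancels in the quotient. -/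
lemma sum_stateTerm (hz : NonDegenerate L κ δ c z w) (hw : NonDegenerate L κ δ c w z)
    (hzw : ∀ i k, brpm L κ (z i) (w k) ≠ 0) (T : ℂ) :
    ∑ s, stateTerm L κ δ a c z w T s =
      (kernelMatrix L κ δ a c z w T).det / (cauchyMatrix L κ z w).det := by
  have hdet : (kernelMatrix L κ δ a c z w T).det = ∑ s : Fin N → Fin 4,
      (∏ i, stateCoeff L κ δ a c T (z i) (s i)) *
        (cauchyMatrix L κ (fun i => z i + stateShift δ (s i)) w).det := by
    have h1 : kernelMatrix L κ δ a c z w T = fun i => ∑ σ, fun k =>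
        stateCoeff L κ δ a c T (z i) σ / brpm L κ (z i + stateShift δ σ) (w k) := by
      ext i k
      simp [kernelMatrix]
    have h2 := (Matrix.detRowAlternating (R := ℂ) (n := Fin N)).toMultilinearMap.map_sum
      (g := fun i σ k =>
        stateCoeff L κ δ a c T (z i) σ / brpm L κ (z i + stateShift δ σ) (w k))
    rw [h1]
    refine h2.trans (Finset.sum_congr rfl fun s _ => ?_)
    rw [← Matrix.det_mul_column]
    refine congr_arg Matrix.det ?_
    ext i k
    simp [cauchyMatrix, div_eq_mul_inv]
  have hK := det_cauchyMatrix_ne_zero L κ hz hw hzw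
  rw [eq_div_iff hK, hdet, Finset.sum_mul]
  refine Finset.sum_congr rfl fun s _ => ?_
  obtain ⟨C, hC, h⟩ := exists_det_cauchy L κ w hw.pair_ne
  rw [cauchyMatrix, cauchyMatrix, h z hzw,
    h _ fun i k => brpm_add_stateShift_ne_zero L κ hz hzw i k (s i)]
  unfold stateTerm
  simp only [Finset.prod_div_distrib]
  have h1 : ∏ i, ∏ j ∈ Finset.Ioi i, brpm L κ (z i) (z j) ≠ 0 :=
    Finset.prod_ne_zero_iff.2 fun i _ => Finset.prod_ne_zero_iff.2 fun j hj =>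
      hz.pair_ne i j (Finset.mem_Ioi.1 hj).ne
  have h2 : ∏ i, ∏ k, brpm L κ (z i) (w k) ≠ 0 :=
    Finset.prod_ne_zero_iff.2 fun i _ => Finset.prod_ne_zero_iff.2 fun k _ => hzw i k
  have h3 : ∏ i, ∏ k, brpm L κ (z i + stateShift δ (s i)) (w k) ≠ 0 :=
    Finset.prod_ne_zero_iff.2 fun i _ => Finset.prod_ne_zero_iff.2 fun k _ =>
      brpm_add_stateShift_ne_zero L κ hz hzw i k (s i)
  field_simp

/-- The duality of the generating functions. -/
theorem sum_stateTerm_dual (hb : ∀ p, b p = δ - a p) (ha : ∑ p, a p = 4 * δ)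
    (hz : NonDegenerate L κ δ c z w) (hw : NonDegenerate L κ δ c w z)
    (hzw : ∀ i k, brpm L κ (z i) (w k) ≠ 0) (T : ℂ) :
    ∑ s, stateTerm L κ δ a c z w T s = ∑ s, stateTerm L κ δ b c w z T s := by
  have hwz : ∀ i k, brpm L κ (w i) (z k) ≠ 0 := fun i k => by
    rw [brpm_swap]; exact neg_ne_zero.2 (hzw k i)
  rw [sum_stateTerm L κ hz hw hzw, sum_stateTerm L κ hw hz hwz]
  have h1 : cauchyMatrix L κ z w = -(cauchyMatrix L κ w z).transpose := by
    ext i k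
    simp only [cauchyMatrix, Matrix.of_apply, Matrix.neg_apply, Matrix.transpose_apply]
    rw [brpm_swap, one_div_neg_eq_neg_one_div]
  have h2 : kernelMatrix L κ δ a c z w T = -(kernelMatrix L κ δ b c w z T).transpose := by
    ext i k
    simp only [kernelMatrix, Matrix.of_apply, Matrix.neg_apply, Matrix.transpose_apply,
      Fin.sum_univ_four, stateCoeff, stateShift, Matrix.cons_val, add_zero, ← sub_eq_add_neg]
    have h3 := kernel_duality L κ hb ha hz hw i k (hzw i k)
    have h4 : 1 / brpm L κ (z i) (w k) = -(1 / brpm L κ (w k) (z i)) := by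
      rw [brpm_swap, one_div_neg_eq_neg_one_div]
    linear_combination h4 + T * h3
  rw [h1, h2, Matrix.det_neg, Matrix.det_neg, Matrix.det_transpose, Matrix.det_transpose,
    mul_div_mul_left]
  simp

end

/-! ### From configurations of states to the sums over subsets -/

section

variable (L : PeriodPair) (κ : ℂ)

/-- The product over the pairs of elements of a finite set of indices splits along a disjoint
union. -/
lemma prod_pairs_union {ι : Type*} [LinearOrder ι] {A B : Finset ι} (hAB : Disjoint A B)
    (G : ι → ι → ℂ) (hG : ∀ i j, G i j = G j i) :
    ∏ i ∈ A ∪ B, ∏ j ∈ A ∪ B with i < j, G i j =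
      (∏ i ∈ A, ∏ j ∈ A with i < j, G i j) * (∏ i ∈ B, ∏ j ∈ B with i < j, G i j) *
        ∏ i ∈ A, ∏ j ∈ B, G i j := by
  have hsplit : ∀ i, ∏ j ∈ A ∪ B with i < j, G i j =
      (∏ j ∈ A with i < j, G i j) * ∏ j ∈ B with i < j, G i j := fun i => by
    rw [Finset.filter_union, Finset.prod_union (Finset.disjoint_filter_filter hAB)]
  have hcross : (∏ i ∈ A, ∏ j ∈ B with i < j, G i j) * (∏ i ∈ B, ∏ j ∈ A with i < j, G i j) =
      ∏ i ∈ A, ∏ j ∈ B, G i j := by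
    have h1 : ∏ i ∈ B, ∏ j ∈ A with i < j, G i j = ∏ i ∈ A, ∏ j ∈ B with ¬ i < j, G i j := by
      simp only [Finset.prod_filter]
      rw [Finset.prod_comm]
      refine Finset.prod_congr rfl fun i hi => Finset.prod_congr rfl fun j hj => ?_
      have hne : i ≠ j := fun h => Finset.disjoint_left.1 hAB hi (h ▸ hj)
      have : j < i ↔ ¬ i < j := by
        rw [not_lt]; exact ⟨le_of_lt, fun h => lt_of_le_of_ne h hne.symm⟩
      simp only [this, hG j i]
    rw [h1, ← Finset.prod_mul_distrib]
    exact Finset.prod_congr rfl fun i _ => Finset.prod_filter_mul_prod_filter_not _ _ _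
  rw [Finset.prod_union hAB]
  simp only [hsplit, Finset.prod_mul_distrib]
  rw [← hcross]
  ring

/-- By inclusion-exclusion, the cardinality condition forces the three sets to be pairwise disjoint.
-/
lemma mem_triples_iff {N : ℕ} {I : Finset (Fin N)}
    {t : Finset (Fin N) × Finset (Fin N) × Finset (Fin N)} :
    t ∈ triples I ↔ t.1 ∪ t.2.1 ∪ t.2.2 = I ∧ Disjoint t.1 t.2.1 ∧ Disjoint t.1 t.2.2 ∧
      Disjoint t.2.1 t.2.2 := by
  obtain ⟨A, B, C⟩ := t
  simp only [triples, Finset.mem_filter, Finset.mem_product, Finset.mem_powerset]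
  constructor
  · rintro ⟨-, hU, hcard⟩
    have h1 := Finset.card_union_add_card_inter (A ∪ B) C
    have h2 := Finset.card_union_add_card_inter A B
    rw [hU] at h1
    have h3 : (A ∪ B) ∩ C = ∅ := by rw [← Finset.card_eq_zero]; omega
    have h4 : A ∩ B = ∅ := by rw [← Finset.card_eq_zero]; omega
    rw [← Finset.disjoint_iff_inter_eq_empty] at h3 h4
    rw [Finset.disjoint_union_left] at h3
    exact ⟨hU, h4, h3.1, h3.2⟩
  · rintro ⟨rfl, h1, h2, h3⟩
    refine ⟨⟨?_, ?_, ?_⟩, rfl, ?_⟩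
    · exact Finset.subset_union_left.trans Finset.subset_union_left
    · exact Finset.subset_union_right.trans Finset.subset_union_left
    · exact Finset.subset_union_right
    · rw [Finset.card_union_of_disjoint (Finset.disjoint_union_left.2 ⟨h2, h3⟩),
        Finset.card_union_of_disjoint h1]

variable {δ : ℂ} {a b : Fin 8 → ℂ} {c : Fin 4 → ℂ} {N : ℕ} {z w : Fin N → ℂ}

/-- The indices in a given state. -/
def stateSet (s : Fin N → Fin 4) (σ : Fin 4) : Finset (Fin N) := Finset.univ.filter (s · = σ)

lemma mem_stateSet {s : Fin N → Fin 4} {σ : Fin 4} {i : Fin N} : i ∈ stateSet s σ ↔ s i = σ := by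
  simp [stateSet]

lemma disjoint_stateSet (s : Fin N → Fin 4) {σ τ : Fin 4} (h : σ ≠ τ) :
    Disjoint (stateSet s σ) (stateSet s τ) := by
  rw [Finset.disjoint_left]
  intro i hi hj
  rw [mem_stateSet] at hi hj
  exact h (hi.symm.trans hj)

lemma prod_eq_prod_stateSet (s : Fin N → Fin 4) (f : Fin N → ℂ) :
    ∏ i, f i = (∏ i ∈ stateSet s 0, f i) * (∏ i ∈ stateSet s 1, f i) *
      (∏ i ∈ stateSet s 2, f i) * ∏ i ∈ stateSet s 3, f i := by
  rw [← Fin.prod_univ_four fun σ => ∏ i ∈ stateSet s σ, f i]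
  exact (Finset.prod_fiberwise Finset.univ s f).symm

/-- In the ratio attached to a pair, equal shifts leave `[z_i - z_j]` unchanged and opposite shifts
leave `[z_i + z_j]` unchanged, so one factor cancels. Pairs of unshifted variables contribute `1`.
-/
lemma stateTerm_eq (hz : NonDegenerate L κ δ c z w) (hzw : ∀ i k, brpm L κ (z i) (w k) ≠ 0) (T : ℂ)
    (s : Fin N → Fin 4) :
    stateTerm L κ δ a c z w T s =
      T ^ (stateSet s 2 ∪ stateSet s 1 ∪ stateSet s 3).card *
        term L κ δ a c z w (stateSet s 2) (stateSet s 1) (stateSet s 3) := by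
  have d21 := disjoint_stateSet s (show (2 : Fin 4) ≠ 1 by decide)
  have d23 := disjoint_stateSet s (show (2 : Fin 4) ≠ 3 by decide)
  have d13 := disjoint_stateSet s (show (1 : Fin 4) ≠ 3 by decide)
  have hcoeff : ∏ i, stateCoeff L κ δ a c T (z i) (s i) =
      T ^ (stateSet s 2 ∪ stateSet s 1 ∪ stateSet s 3).card *
        ((∏ i ∈ stateSet s 2, APlus L κ δ a (z i)) * (∏ i ∈ stateSet s 1, AZero L κ δ a c (z i)) *
          ∏ i ∈ stateSet s 3, AMinus L κ δ a (z i)) := by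
    have h : ∀ σ, ∏ i ∈ stateSet s σ, stateCoeff L κ δ a c T (z i) (s i) =
        ∏ i ∈ stateSet s σ, stateCoeff L κ δ a c T (z i) σ := fun σ =>
      Finset.prod_congr rfl fun i hi => by rw [mem_stateSet.1 hi]
    rw [prod_eq_prod_stateSet s, h, h, h, h]
    simp only [stateCoeff, Matrix.cons_val, Finset.prod_const_one, Finset.prod_mul_distrib,
      Finset.prod_const]
    rw [Finset.card_union_of_disjoint (Finset.disjoint_union_left.2 ⟨d23, d13⟩),
      Finset.card_union_of_disjoint d21, pow_add, pow_add]
    ring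
  have hW : ∏ i, ∏ k, brpm L κ (z i) (w k) / brpm L κ (z i + stateShift δ (s i)) (w k) =
      (∏ i ∈ stateSet s 2, ∏ k, brpm L κ (z i) (w k) / brpm L κ (z i + δ) (w k)) *
        ∏ i ∈ stateSet s 3, ∏ k, brpm L κ (z i) (w k) / brpm L κ (z i - δ) (w k) := by
    have h : ∀ σ, ∏ i ∈ stateSet s σ, ∏ k, brpm L κ (z i) (w k) /
          brpm L κ (z i + stateShift δ (s i)) (w k) =
        ∏ i ∈ stateSet s σ, ∏ k, brpm L κ (z i) (w k) /
          brpm L κ (z i + stateShift δ σ) (w k) := fun σ =>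
      Finset.prod_congr rfl fun i hi => by rw [mem_stateSet.1 hi]
    rw [prod_eq_prod_stateSet s, h, h, h, h]
    simp only [stateShift, Matrix.cons_val, add_zero, div_self (hzw _ _), Finset.prod_const_one,
      one_mul, ← sub_eq_add_neg]
  set G : Fin N → Fin N → ℂ := fun i j =>
    brpm L κ (z i + stateShift δ (s i)) (z j + stateShift δ (s j)) / brpm L κ (z i) (z j) with hG
  -- Numerator and denominator are both antisymmetric, so the order within a pair is immaterial.
  have hGsymm : ∀ i j, G i j = G j i := fun i j => by
    simp only [hG]
    rw [brpm_swap, brpm_swap L κ (z i), neg_div_neg_eq]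
  have hshift : ∀ {i σ}, i ∈ stateSet s σ → stateShift δ (s i) = stateShift δ σ := fun hi => by
    rw [mem_stateSet.1 hi]
  have s2 : ∀ {i}, i ∈ stateSet s 2 → stateShift δ (s i) = δ := fun hi => by
    rw [hshift hi]; rfl
  have s3 : ∀ {i}, i ∈ stateSet s 3 → stateShift δ (s i) = -δ := fun hi => by
    rw [hshift hi]; rfl
  have s0 : ∀ {i}, i ∈ (stateSet s 2 ∪ stateSet s 3)ᶜ → stateShift δ (s i) = 0 := by
    intro i hi
    simp only [Finset.mem_compl, Finset.mem_union, mem_stateSet, not_or] at hi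
    generalize s i = σ at *
    fin_cases σ
    · rfl
    · rfl
    · simp at hi
    · simp at hi
  have hne : ∀ {i j}, i ≠ j → br L κ (z i + z j) ≠ 0 ∧ br L κ (z i - z j) ≠ 0 := fun h =>
    mul_ne_zero_iff.1 (hz.pair_ne _ _ h)
  have hpairs : ∏ i, ∏ j ∈ Finset.Ioi i, G i j =
      (∏ i ∈ stateSet s 2, ∏ j ∈ stateSet s 2 with i < j,
        br L κ (z i + z j + 2 * δ) / br L κ (z i + z j)) *
      (∏ i ∈ stateSet s 3, ∏ j ∈ stateSet s 3 with i < j,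
        br L κ (z i + z j - 2 * δ) / br L κ (z i + z j)) *
      (∏ i ∈ stateSet s 2, ∏ j ∈ stateSet s 3,
        br L κ (z i - z j + 2 * δ) / br L κ (z i - z j)) *
      (∏ i ∈ stateSet s 2, ∏ j ∈ (stateSet s 2 ∪ stateSet s 3)ᶜ,
        brpm L κ (z i + δ) (z j) / brpm L κ (z i) (z j)) *
      (∏ i ∈ stateSet s 3, ∏ j ∈ (stateSet s 2 ∪ stateSet s 3)ᶜ,
        brpm L κ (z i - δ) (z j) / brpm L κ (z i) (z j)) := by
    have h1 : ∏ i, ∏ j ∈ Finset.Ioi i, G i j =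
        ∏ i ∈ (stateSet s 2 ∪ stateSet s 3) ∪ (stateSet s 2 ∪ stateSet s 3)ᶜ,
          ∏ j ∈ (stateSet s 2 ∪ stateSet s 3) ∪ (stateSet s 2 ∪ stateSet s 3)ᶜ with i < j,
            G i j := by
      rw [Finset.union_compl]
      refine Finset.prod_congr rfl fun i _ => Finset.prod_congr ?_ fun _ _ => rfl
      ext j; simp
    have hcompl : ∏ i ∈ (stateSet s 2 ∪ stateSet s 3)ᶜ,
        ∏ j ∈ (stateSet s 2 ∪ stateSet s 3)ᶜ with i < j, G i j = 1 := by
      refine Finset.prod_eq_one fun i hi => Finset.prod_eq_one fun j hj => ?_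
      obtain ⟨hj, hij⟩ := Finset.mem_filter.1 hj
      simp only [hG]
      rw [s0 hi, s0 hj, add_zero, add_zero, div_self (hz.pair_ne i j hij.ne)]
    rw [h1, prod_pairs_union disjoint_compl_right G hGsymm, hcompl, mul_one,
      prod_pairs_union d23 G hGsymm, Finset.prod_union d23]
    have e1 : ∏ i ∈ stateSet s 2, ∏ j ∈ stateSet s 2 with i < j, G i j =
        ∏ i ∈ stateSet s 2, ∏ j ∈ stateSet s 2 with i < j,
          br L κ (z i + z j + 2 * δ) / br L κ (z i + z j) := by
      refine Finset.prod_congr rfl fun i hi => Finset.prod_congr rfl fun j hj => ?_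
      obtain ⟨hj, hij⟩ := Finset.mem_filter.1 hj
      simp only [hG]
      rw [s2 hi, s2 hj, brpm, brpm, show z i + δ + (z j + δ) = z i + z j + 2 * δ by ring,
        show z i + δ - (z j + δ) = z i - z j by ring, mul_div_mul_right _ _ (hne hij.ne).2]
    have e2 : ∏ i ∈ stateSet s 3, ∏ j ∈ stateSet s 3 with i < j, G i j =
        ∏ i ∈ stateSet s 3, ∏ j ∈ stateSet s 3 with i < j,
          br L κ (z i + z j - 2 * δ) / br L κ (z i + z j) := by
      refine Finset.prod_congr rfl fun i hi => Finset.prod_congr rfl fun j hj => ?_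
      obtain ⟨hj, hij⟩ := Finset.mem_filter.1 hj
      simp only [hG]
      rw [s3 hi, s3 hj, brpm, brpm, show z i + -δ + (z j + -δ) = z i + z j - 2 * δ by ring,
        show z i + -δ - (z j + -δ) = z i - z j by ring, mul_div_mul_right _ _ (hne hij.ne).2]
    have e3 : ∏ i ∈ stateSet s 2, ∏ j ∈ stateSet s 3, G i j =
        ∏ i ∈ stateSet s 2, ∏ j ∈ stateSet s 3,
          br L κ (z i - z j + 2 * δ) / br L κ (z i - z j) := by
      refine Finset.prod_congr rfl fun i hi => Finset.prod_congr rfl fun j hj => ?_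
      have hij : i ≠ j := fun h => Finset.disjoint_left.1 d23 hi (h ▸ hj)
      simp only [hG]
      rw [s2 hi, s3 hj, brpm, brpm, show z i + δ + (z j + -δ) = z i + z j by ring,
        show z i + δ - (z j + -δ) = z i - z j + 2 * δ by ring, mul_div_mul_left _ _ (hne hij).1]
    have e4 : ∏ i ∈ stateSet s 2, ∏ j ∈ (stateSet s 2 ∪ stateSet s 3)ᶜ, G i j =
        ∏ i ∈ stateSet s 2, ∏ j ∈ (stateSet s 2 ∪ stateSet s 3)ᶜ,
          brpm L κ (z i + δ) (z j) / brpm L κ (z i) (z j) := by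
      refine Finset.prod_congr rfl fun i hi => Finset.prod_congr rfl fun j hj => ?_
      simp only [hG]
      rw [s2 hi, s0 hj, add_zero]
    have e5 : ∏ i ∈ stateSet s 3, ∏ j ∈ (stateSet s 2 ∪ stateSet s 3)ᶜ, G i j =
        ∏ i ∈ stateSet s 3, ∏ j ∈ (stateSet s 2 ∪ stateSet s 3)ᶜ,
          brpm L κ (z i - δ) (z j) / brpm L κ (z i) (z j) := by
      refine Finset.prod_congr rfl fun i hi => Finset.prod_congr rfl fun j hj => ?_
      simp only [hG]
      rw [s3 hi, s0 hj, add_zero, ← sub_eq_add_neg]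
    rw [e1, e2, e3, e4, e5]
    ring
  unfold stateTerm term
  rw [hcoeff, hW, hpairs]
  ring

/-- A configuration of states is the same as a subset `I` with a triple `(I₊, I₀, I₋)`. -/
lemma sum_states_eq (f : Finset (Fin N) → Finset (Fin N) → Finset (Fin N) → Finset (Fin N) → ℂ) :
    ∑ s : Fin N → Fin 4, f (stateSet s 2 ∪ stateSet s 1 ∪ stateSet s 3)
        (stateSet s 2) (stateSet s 1) (stateSet s 3) =
      ∑ I ∈ (Finset.univ : Finset (Fin N)).powerset, ∑ t ∈ triples I, f I t.1 t.2.1 t.2.2 := by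
  rw [Finset.sum_sigma']
  refine Finset.sum_bij'
    (fun s _ => ⟨stateSet s 2 ∪ stateSet s 1 ∪ stateSet s 3,
      stateSet s 2, stateSet s 1, stateSet s 3⟩)
    (fun p _ i => if i ∈ p.2.1 then 2 else if i ∈ p.2.2.1 then 1 else if i ∈ p.2.2.2 then 3 else 0)
    ?_ ?_ ?_ ?_ ?_
  · intro s _
    rw [Finset.mem_sigma, mem_triples_iff]
    exact ⟨by simp, rfl, disjoint_stateSet s (by decide), disjoint_stateSet s (by decide),
      disjoint_stateSet s (by decide)⟩
  · simp
  · intro s _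
    ext1 i
    simp only [mem_stateSet]
    generalize s i = σ
    fin_cases σ <;> simp
  · rintro ⟨I, A, B, C⟩ h
    obtain ⟨-, h⟩ := Finset.mem_sigma.1 h
    dsimp only at h ⊢
    obtain ⟨rfl, h1, h2, h3⟩ := mem_triples_iff.1 h
    simp only [Finset.disjoint_left] at h1 h2 h3
    set s : Fin N → Fin 4 :=
      fun i => if i ∈ A then 2 else if i ∈ B then 1 else if i ∈ C then 3 else 0 with hs
    have eA : stateSet s 2 = A := by
      ext i; rw [mem_stateSet]; simp only [hs]; split_ifs <;> simp_all
    have eB : stateSet s 1 = B := by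
      ext i; rw [mem_stateSet]; simp only [hs]; split_ifs <;> simp_all
    have eC : stateSet s 3 = C := by
      ext i; rw [mem_stateSet]; simp only [hs]; split_ifs <;> simp_all
    simp only [eA, eB, eC]
  · intro s _
    rfl

lemma sum_stateTerm_eq_sum_subsetSum (hz : NonDegenerate L κ δ c z w)
    (hzw : ∀ i k, brpm L κ (z i) (w k) ≠ 0) (T : ℂ) :
    ∑ s, stateTerm L κ δ a c z w T s =
      ∑ r ∈ Finset.range (N + 1), subsetSum L κ δ a c z w r * T ^ r := by
  simp only [stateTerm_eq L κ hz hzw]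
  rw [sum_states_eq fun I A B C => T ^ I.card * term L κ δ a c z w A B C, Finset.sum_powerset,
    Finset.card_univ, Fintype.card_fin]
  refine Finset.sum_congr rfl fun r _ => ?_
  rw [subsetSum, Finset.sum_mul]
  refine Finset.sum_congr rfl fun I hI => ?_
  rw [(Finset.mem_powersetCard.1 hI).2, ← Finset.mul_sum, mul_comm]

/-- The generating functions are polynomials in `T` that agree at every `T`, so their coefficients
agree. -/
theorem subsetSum_dual_of_generic (hb : ∀ p, b p = δ - a p) (ha : ∑ p, a p = 4 * δ)
    (hz : NonDegenerate L κ δ c z w) (hw : NonDegenerate L κ δ c w z)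
    (hzw : ∀ i k, brpm L κ (z i) (w k) ≠ 0) {r : ℕ} (hr : r ≤ N) :
    subsetSum L κ δ a c z w r = subsetSum L κ δ b c w z r := by
  have hwz : ∀ i k, brpm L κ (w i) (z k) ≠ 0 := fun i k => by
    rw [brpm_swap]; exact neg_ne_zero.2 (hzw k i)
  have key : ∀ f : ℕ → ℂ, (∑ r ∈ Finset.range (N + 1),
      Polynomial.C (f r) * Polynomial.X ^ r : Polynomial ℂ).coeff r = f r := fun f => by
    simp only [Polynomial.finsetSum_coeff, Polynomial.coeff_C_mul_X_pow]
    rw [Finset.sum_ite_eq, if_pos (Finset.mem_range.2 (by omega))]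
  have heval : ∀ (f : ℕ → ℂ) (T : ℂ), (∑ r ∈ Finset.range (N + 1),
      Polynomial.C (f r) * Polynomial.X ^ r : Polynomial ℂ).eval T =
        ∑ r ∈ Finset.range (N + 1), f r * T ^ r := fun f T => by
    simp [Polynomial.eval_finsetSum]
  have hpoly : (∑ r ∈ Finset.range (N + 1),
      Polynomial.C (subsetSum L κ δ a c z w r) * Polynomial.X ^ r : Polynomial ℂ) =
      ∑ r ∈ Finset.range (N + 1),
        Polynomial.C (subsetSum L κ δ b c w z r) * Polynomial.X ^ r := by
    refine Polynomial.funext fun T => ?_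
    rw [heval (subsetSum L κ δ a c z w), heval (subsetSum L κ δ b c w z),
      ← sum_stateTerm_eq_sum_subsetSum L κ hz hzw, ← sum_stateTerm_eq_sum_subsetSum L κ hw hwz]
    exact sum_stateTerm_dual L κ hb ha hz hw hzw T
  rw [← key (subsetSum L κ δ a c z w), hpoly, key (subsetSum L κ δ b c w z)]

end

/-! ### Removing the condition `[z_i ± w_k] ≠ 0` by continuity -/

section

variable (L : PeriodPair) (κ : ℂ)

variable {δ : ℂ} {a b : Fin 8 → ℂ} {c : Fin 4 → ℂ} {N : ℕ} {z w : Fin N → ℂ}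

lemma continuous_brpm {f g : ℂ → ℂ} (hf : Continuous f) (hg : Continuous g) :
    Continuous fun τ => brpm L κ (f τ) (g τ) := by
  have := continuous_br L κ
  unfold brpm; fun_prop

/-- The factors `[z_i ± w_k]` occur only in numerators, so continuity holds at their zeros too; this
is what the limit argument needs. -/
lemma continuousAt_subsetSum {Z W : ℂ → Fin N → ℂ} (hZ : Continuous Z) (hW : Continuous W)
    {τ₀ : ℂ} (h : NonDegenerate L κ δ c (Z τ₀) (W τ₀)) (r : ℕ) :
    ContinuousAt (fun τ => subsetSum L κ δ a c (Z τ) (W τ) r) τ₀ := by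
  have hb := continuous_br L κ
  have hz : ∀ i, Continuous fun τ => Z τ i := fun i => (continuous_apply i).comp hZ
  have hw : ∀ i, Continuous fun τ => W τ i := fun i => (continuous_apply i).comp hW
  have hpm : ∀ i j, i ≠ j → br L κ (Z τ₀ i + Z τ₀ j) ≠ 0 ∧ br L κ (Z τ₀ i - Z τ₀ j) ≠ 0 :=
    fun i j hij => mul_ne_zero_iff.1 (h.pair_ne i j hij)
  unfold subsetSum
  refine tendsto_finsetSum _ fun I _ => tendsto_finsetSum _ fun t ht => ?_
  obtain ⟨-, h1, h2, h3⟩ := mem_triples_iff.1 ht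
  obtain ⟨A, B, C⟩ := t
  unfold term
  refine ((((((((Tendsto.mul ?_ ?_).mul ?_).mul ?_).mul ?_).mul ?_).mul ?_).mul ?_).mul ?_).mul ?_
  · refine tendsto_finsetProd _ fun i _ => ?_
    unfold APlus
    exact ContinuousAt.div (Continuous.continuousAt (by fun_prop))
      (Continuous.continuousAt (by fun_prop)) (mul_ne_zero (h.two_mul_ne i) (h.two_mul_add_ne i))
  · refine tendsto_finsetProd _ fun i _ => tendsto_finsetSum _ fun s _ => ?_
    unfold AZeroTerm
    have c1 := continuous_brpm L κ (hz i) (continuous_const (y := c s))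
    have c2 := continuous_brpm L κ (continuous_const (y := (om L s - δ) / 2)) (hz i)
    refine ContinuousAt.mul continuousAt_const (ContinuousAt.div
      (Continuous.continuousAt (by fun_prop)) (Continuous.continuousAt (by fun_prop)) ?_)
    exact mul_ne_zero (mul_ne_zero two_ne_zero (h.half_ne s i)) (h.half_c_ne s)
  · refine tendsto_finsetProd _ fun i _ => ?_
    unfold AMinus
    exact ContinuousAt.div (Continuous.continuousAt (by fun_prop))
      (Continuous.continuousAt (by fun_prop)) (mul_ne_zero (h.two_mul_ne i) (h.two_mul_sub_ne i))
  · refine tendsto_finsetProd _ fun i _ => tendsto_finsetProd _ fun j hj => ?_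
    exact ContinuousAt.div (Continuous.continuousAt (by fun_prop))
      (Continuous.continuousAt (by fun_prop)) (hpm i j (Finset.mem_filter.1 hj).2.ne).1
  · refine tendsto_finsetProd _ fun i _ => tendsto_finsetProd _ fun j hj => ?_
    exact ContinuousAt.div (Continuous.continuousAt (by fun_prop))
      (Continuous.continuousAt (by fun_prop)) (hpm i j (Finset.mem_filter.1 hj).2.ne).1
  · refine tendsto_finsetProd _ fun i hi => tendsto_finsetProd _ fun j hj => ?_
    exact ContinuousAt.div (Continuous.continuousAt (by fun_prop))
      (Continuous.continuousAt (by fun_prop))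
      (hpm i j fun hij => Finset.disjoint_left.1 h2 hi (hij ▸ hj)).2
  · refine tendsto_finsetProd _ fun i hi => tendsto_finsetProd _ fun j hj => ?_
    refine ContinuousAt.div (continuous_brpm L κ ((hz i).add_const δ) (hz j)).continuousAt
      (continuous_brpm L κ (hz i) (hz j)).continuousAt (h.pair_ne i j ?_)
    rintro rfl
    simp [hi] at hj
  · refine tendsto_finsetProd _ fun i hi => tendsto_finsetProd _ fun j hj => ?_
    refine ContinuousAt.div (continuous_brpm L κ ((hz i).sub continuous_const) (hz j)).continuousAt
      (continuous_brpm L κ (hz i) (hz j)).continuousAt (h.pair_ne i j ?_)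
    rintro rfl
    simp [hi] at hj
  · exact tendsto_finsetProd _ fun i _ => tendsto_finsetProd _ fun k _ =>
      ContinuousAt.div (continuous_brpm L κ (hz i) (hw k)).continuousAt
        (continuous_brpm L κ ((hz i).add_const δ) (hw k)).continuousAt (h.add_ne i k)
  · exact tendsto_finsetProd _ fun i _ => tendsto_finsetProd _ fun k _ =>
      ContinuousAt.div (continuous_brpm L κ (hz i) (hw k)).continuousAt
        (continuous_brpm L κ ((hz i).sub continuous_const) (hw k)).continuousAt (h.sub_ne i k)

lemma eventually_nonDegenerate {Z W : ℂ → Fin N → ℂ} (hZ : Continuous Z) (hW : Continuous W)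
    {τ₀ : ℂ} (h : NonDegenerate L κ δ c (Z τ₀) (W τ₀)) :
    ∀ᶠ τ in 𝓝 τ₀, NonDegenerate L κ δ c (Z τ) (W τ) := by
  have hb := continuous_br L κ
  have hz : ∀ i, Continuous fun τ => Z τ i := fun i => (continuous_apply i).comp hZ
  have hw : ∀ i, Continuous fun τ => W τ i := fun i => (continuous_apply i).comp hW
  have ev : ∀ f : ℂ → ℂ, Continuous f → f τ₀ ≠ 0 → ∀ᶠ τ in 𝓝 τ₀, f τ ≠ 0 :=
    fun f hf h0 => hf.continuousAt.eventually_ne h0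
  have e1 := eventually_all.2 fun i => ev (fun τ => br L κ (2 * Z τ i)) (by fun_prop) (h.two_mul_ne i)
  have e2 := eventually_all.2 fun i =>
    ev (fun τ => br L κ (2 * Z τ i + δ)) (by fun_prop) (h.two_mul_add_ne i)
  have e3 := eventually_all.2 fun i =>
    ev (fun τ => br L κ (2 * Z τ i - δ)) (by fun_prop) (h.two_mul_sub_ne i)
  have e4 := eventually_all.2 fun r => eventually_all.2 fun i =>
    ev _ (continuous_brpm L κ continuous_const (hz i)) (h.half_ne r i)
  have e5 := eventually_all.2 fun i => eventually_all.2 fun j => eventually_all.2 fun hij : i ≠ j =>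
    ev _ (continuous_brpm L κ (hz i) (hz j)) (h.pair_ne i j hij)
  have e6 := eventually_all.2 fun i => eventually_all.2 fun k =>
    ev _ (continuous_brpm L κ ((hz i).add_const δ) (hw k)) (h.add_ne i k)
  have e7 := eventually_all.2 fun i => eventually_all.2 fun k =>
    ev _ (continuous_brpm L κ ((hz i).sub continuous_const) (hw k)) (h.sub_ne i k)
  filter_upwards [e1, e2, e3, e4, e5, e6, e7] with τ h1 h2 h3 h4 h5 h6 h7
  exact ⟨h1, h2, h3, h4, h.half_c_ne, h5, h6, h7⟩

/-- Only countably many common shifts `τ` of the `z_i` are excluded. -/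
lemma frequently_brpm_ne_zero (z w : Fin N → ℂ) :
    ∃ᶠ τ in 𝓝 (0 : ℂ), ∀ i k, brpm L κ (z i + τ) (w k) ≠ 0 := by
  have hd : Dense (⋃ i, ⋃ k, ({τ | τ + (z i + w k) ∈ (L.lattice : Set ℂ)} ∪
      {τ | τ + (z i - w k) ∈ (L.lattice : Set ℂ)}))ᶜ := by
    refine Set.Countable.dense_compl ℝ (Set.countable_iUnion fun i => Set.countable_iUnion fun k => ?_)
    have hL := countable_lattice L
    exact (hL.preimage (add_left_injective (z i + w k))).union
      (hL.preimage (add_left_injective (z i - w k)))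
  refine (mem_closure_iff_frequently.1 (hd 0)).mono fun τ hτ i k => ?_
  simp only [Set.mem_compl_iff, Set.mem_iUnion, Set.mem_union, Set.mem_ofPred_eq, not_exists,
    not_or] at hτ
  rw [Ne, brpm_eq_zero_iff]
  rintro (h | h)
  · exact (hτ i k).1 (by convert! h using 1; ring)
  · exact (hτ i k).2 (by convert! h using 1; ring)

theorem subsetSum_dual (hb : ∀ p, b p = δ - a p) (ha : ∑ p, a p = 4 * δ)
    (hz : NonDegenerate L κ δ c z w) (hw : NonDegenerate L κ δ c w z) {r : ℕ} (hr : r ≤ N) :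
    subsetSum L κ δ a c z w r = subsetSum L κ δ b c w z r := by
  -- Both sides are continuous at `τ = 0` along this shift and agree for suitable `τ` arbitrarily
  -- close to `0`.
  set Z : ℂ → Fin N → ℂ := fun τ i => z i + τ with hZ
  have hZc : Continuous Z := by fun_prop
  have hZ0 : Z 0 = z := by ext i; simp [hZ]
  rw [← hZ0] at hz hw ⊢
  have hWc : Continuous fun _ : ℂ => w := continuous_const
  refine tendsto_nhds_unique_of_frequently_eq
    (continuousAt_subsetSum L κ hZc hWc hz r) (continuousAt_subsetSum L κ hWc hZc hw r) ?_
  refine ((frequently_brpm_ne_zero L κ z w).and_eventually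
    ((eventually_nonDegenerate L κ hZc hWc hz).and
      (eventually_nonDegenerate L κ hWc hZc hw))).mono fun τ hτ => ?_
  exact subsetSum_dual_of_generic L κ hb ha hτ.2.1 hτ.2.2 hτ.1 hr

end

end BCDuality

end

theorem mainTheorem3 (L : PeriodPair) (κ δ : ℂ) (hδ : δ ≠ 0)
    (hδΩ : ∀ n : ℤ, (n : ℂ) * δ ∈ L.lattice → (n : ℂ) * δ = 0)
    (a b : Fin 8 → ℂ) (hb : ∀ p, b p = δ - a p) (ha : ∑ p, a p = 4 * δ)
    (c : Fin 4 → ℂ) (N : ℕ) (z w : Fin N → ℂ)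
    (hz : BCDuality.NonDegenerate L κ δ c z w) (hw : BCDuality.NonDegenerate L κ δ c w z)
    (r : ℕ) (hr : r ≤ N) :
    BCDuality.subsetSum L κ δ a c z w r = BCDuality.subsetSum L κ δ b c w z r :=
  BCDuality.subsetSum_dual L κ hb ha hz hw hr
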